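/- For integers $0<r_1<r_2<r_3$ and $x_1,x_2,x_3\ge 1$ let $\mathbf q=(\mathbf r,\mathbf x)=(r_1^{x_1},r_2^{x_2},r_3^{x_3})\in\mathbb Z^n$, $n=x_1+x_2+x_3$, be the vector with $x_1$ entries $r_1$, then $x_2$ entries $r_2$, then $x_3$ entries $r_3$, and let $\Delta_{(1,\mathbf q)}=\operatorname{conv}\{e_1,\dots,e_n,-\sum_i q_ie_i\}\subset\mathbb R^n$. For a lattice polytope $P\subset\mathbb R^n$ let $\operatorname{cone}(P)\subset\mathbb R^{n+1}$ be the non-negative span of $\{1\}\times P$. $P$ is *IDP* if for every integer $m\ge1$ every $(m,w)\in\operatorname{cone}(P)\cap\mathbb Z^{n+1}$ is a sum of $m$ points $(1,p)$ with $p\in P\cap\mathbb Z^n$, and *reflexive* if there is $c\in P^\circ\cap\mathbb Z^n$ with $(1,c)+(\operatorname{cone}(P)\cap\mathbb Z^{n+1})=\operatorname{cone}(P)^\circ\cap\mathbb Z^{n+1}$. The pair $(\mathbf r,\mathbf x)$ satisfies the *necessary condition for IDP* if $$1+\sum_{i=1}^3 x_i\,(r_i \bmod r_j)=r_j\qquad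 (j=1,2,3).$$ **Theorem.** If $(\mathbf r,\mathbf x)$ satisfies the necessary condition for IDP, then $\mathbf r$ is of one of the following forms: - (i) $\mathbf r=(1,\;1+x_1,\;(1+x_1)(1+x_2))$; - (ii) $\mathbf r=(1+x_2,\;1+x_1(1+x_2),\;(1+x_1(1+x_2))(1+x_2))$; - (iii) $\mathbf r=((1+x_2)(1+x_3),\;1+x_1(1+x_2)(1+x_3),\;(1+x_1(1+x_2)(1+x_3))(1+x_2))$; - (iv) $\mathbf r=(1,\;(1+x_1)(1+x_3),\;(1+x_1)(1+x_2(1+x_3)))$; - (v) $\mathbf r=(1+(1+x_3)x_2,\;(1+x_3)(1+x_1(1+(1+x_3)x_2)),\;(1+(1+(1+x_3)x_2)x_1)(1+(1+x_3)x_2))$; - (vi) $\mathbf r=((1+x_3)(1+(1+x_3)x_2),\;(1+x_3)(1+x_1(1+x_3)(1+(1+x_3)x_2)),\;(1+(1+x_3)(1+(1+x_3)x_2)x_1)(1+(1+x_3)x_2))$; - (vii) $\mathbf r=(1+x_3,\;(1+x_3)(1+x_1(1+x_3)),\;(1+(1+x_3)x_1)(1+(1+x_3)x_2))$; - (viii)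 for some integers $k,s\ge1$ we have $x_3=skx_2+s+k-1$ and $\mathbf r=(1+kx_2,\;(skx_2+s+k)(1+x_1(1+kx_2)),\;(1+x_1(1+kx_2))(1+x_2(skx_2+s+k)))$. Conversely, for all integers $x_1,x_2,x_3\ge1$, each $\mathbf r$ of type (i)–(viii) has $0<r_1<r_2<r_3$, and $(\mathbf r,\mathbf x)$ satisfies the necessary condition and $\Delta_{(1,\mathbf q)}$ is reflexive. For types (i)–(vii) the simplex $\Delta_{(1,\mathbf q)}$ is IDP; for type (viii) it is not IDP. Consequently, for all integers $0<r_1<r_2<r_3$ and $x_1,x_2,x_3\ge1$, the simplex $\Delta_{(1,\mathbf q)}$ is reflexive and IDP if and only if $\mathbf r$ is of one of the forms (i)–(vii). -/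

import Mathlib

/-- The simplex `Δ_(1,q) = conv {e₁, …, eₙ, -∑ qᵢ eᵢ}` in `ℝⁿ`. -/
def weightedSimplex {n : ℕ} (q : Fin n → ℕ) : Set (Fin n → ℝ) :=
  convexHull ℝ
    (insert (fun i => -(q i : ℝ)) (Set.range fun i : Fin n => (Pi.single i 1 : Fin n → ℝ)))

/-- The cone over `P ⊆ ℝⁿ`, the non-negative span of `{1} × P` in `ℝ × ℝⁿ` (for a polytope `P`
this is also the non-negative span of `{1} × {vertices of P}`). -/
def coneOver {n : ℕ} (P : Set (Fin n → ℝ)) : Set (ℝ × (Fin n → ℝ)) :=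
  (PointedCone.hull ℝ ((fun p : Fin n → ℝ => ((1 : ℝ), p)) '' P) : Set (ℝ × (Fin n → ℝ)))

/-- The inclusion of `ℤⁿ` in `ℝⁿ`. -/
def latticePoint {n : ℕ} (w : Fin n → ℤ) : Fin n → ℝ := fun i => (w i : ℝ)

/-- The integer decomposition property: every lattice point `(m, w)`, `m ≥ 1`, of the cone over
`P` is a sum of `m` points `(1, pₖ)` with `pₖ` a lattice point of `P`. -/
def IsIDP {n : ℕ} (P : Set (Fin n → ℝ)) : Prop :=
  ∀ m : ℕ, 0 < m → ∀ w : Fin n → ℤ, ((m : ℝ), latticePoint w) ∈ coneOver P →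
    ∃ p : Fin m → (Fin n → ℤ), (∀ k, latticePoint (p k) ∈ P) ∧ w = ∑ k, p k

/-- `P` is reflexive: for some lattice point `c` in the interior of `P`, the lattice points of the
interior of the cone over `P` are exactly the translates by `(1, c)` of the lattice points of
the cone over `P`. -/
def IsReflexivePolytope {n : ℕ} (P : Set (Fin n → ℝ)) : Prop :=
  ∃ c : Fin n → ℤ, latticePoint c ∈ interior P ∧
    ∀ (m : ℤ) (w : Fin n → ℤ),
      ((m : ℝ), latticePoint w) ∈ interior (coneOver P) ↔
        (((m - 1 : ℤ) : ℝ), latticePoint (w - c)) ∈ coneOver P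

/-- The vector `(r₁^{x₁}, …, r_d^{x_d}) ∈ ℤⁿ`, `n = ∑ xⱼ`: first `x₁` entries equal to `r₁`, then
`x₂` entries equal to `r₂`, and so on. -/
def weightVector {d : ℕ} (r x : Fin d → ℕ) : Fin (∑ j, x j) → ℕ :=
  fun i => r (finSigmaFinEquiv.symm i).1

/-- `(r, x)` is the pair of support vector and multiplicity vector of a weakly increasing vector
of positive integers with exactly `d` distinct entries. -/
def IsSupportPair {d : ℕ} (r x : Fin d → ℕ) : Prop :=
  StrictMono r ∧ (∀ j, 0 < r j) ∧ ∀ j, 0 < x j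

/-- The necessary condition for IDP: `1 + ∑ᵢ xᵢ (rᵢ mod rⱼ) = rⱼ` for all `j`. -/
def NecessaryCondition {d : ℕ} (r x : Fin d → ℕ) : Prop :=
  ∀ j, 1 + ∑ i, x i * (r i % r j) = r j

/-- The support vector of type (i) with multiplicities `x₁, x₂, x₃`. -/
def typeI (x₁ x₂ _x₃ : ℕ) : Fin 3 → ℕ :=
  ![1, 1 + x₁, (1 + x₁) * (1 + x₂)]

/-- The support vector of type (ii). -/
def typeII (x₁ x₂ _x₃ : ℕ) : Fin 3 → ℕ :=
  ![1 + x₂, 1 + x₁ * (1 + x₂), (1 + x₁ * (1 + x₂)) * (1 + x₂)]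

/-- The support vector of type (iii). -/
def typeIII (x₁ x₂ x₃ : ℕ) : Fin 3 → ℕ :=
  ![(1 + x₂) * (1 + x₃), 1 + x₁ * (1 + x₂) * (1 + x₃),
    (1 + x₁ * (1 + x₂) * (1 + x₃)) * (1 + x₂)]

/-- The support vector of type (iv). -/
def typeIV (x₁ x₂ x₃ : ℕ) : Fin 3 → ℕ :=
  ![1, (1 + x₁) * (1 + x₃), (1 + x₁) * (1 + x₂ * (1 + x₃))]

/-- The support vector of type (v). -/
def typeV (x₁ x₂ x₃ : ℕ) : Fin 3 → ℕ :=
  ![1 + (1 + x₃) * x₂, (1 + x₃) * (1 + x₁ * (1 + (1 + x₃) * x₂)),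
    (1 + (1 + (1 + x₃) * x₂) * x₁) * (1 + (1 + x₃) * x₂)]

/-- The support vector of type (vi). -/
def typeVI (x₁ x₂ x₃ : ℕ) : Fin 3 → ℕ :=
  ![(1 + x₃) * (1 + (1 + x₃) * x₂), (1 + x₃) * (1 + x₁ * (1 + x₃) * (1 + (1 + x₃) * x₂)),
    (1 + (1 + x₃) * (1 + (1 + x₃) * x₂) * x₁) * (1 + (1 + x₃) * x₂)]

/-- The support vector of type (vii). -/
def typeVII (x₁ x₂ x₃ : ℕ) : Fin 3 → ℕ :=
  ![1 + x₃, (1 + x₃) * (1 + x₁ * (1 + x₃)), (1 + (1 + x₃) * x₁) * (1 + (1 + x₃) * x₂)]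

/-- `r` is of one of the types (i)–(vii) for the multiplicities `x`. -/
def IsTypeItoVII (r x : Fin 3 → ℕ) : Prop :=
  r = typeI (x 0) (x 1) (x 2) ∨ r = typeII (x 0) (x 1) (x 2) ∨ r = typeIII (x 0) (x 1) (x 2) ∨
  r = typeIV (x 0) (x 1) (x 2) ∨ r = typeV (x 0) (x 1) (x 2) ∨ r = typeVI (x 0) (x 1) (x 2) ∨
  r = typeVII (x 0) (x 1) (x 2)

/-- `(r, x)` is of type (viii): for some `k, s ≥ 1`, `x₃ = s k x₂ + s + k - 1` and `r` is
`(1 + k x₂, (s k x₂ + s + k)(1 + x₁ (1 + k x₂)), (1 + x₁ (1 + k x₂))(1 + x₂ (s k x₂ + s + k)))`.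
The equation for `x₃` is written without subtraction. -/
def IsTypeVIII (r x : Fin 3 → ℕ) : Prop :=
  ∃ k s : ℕ, 1 ≤ k ∧ 1 ≤ s ∧ x 2 + 1 = s * k * x 1 + s + k ∧
    r = ![1 + k * x 1,
          (s * k * x 1 + s + k) * (1 + x 0 * (1 + k * x 1)),
          (1 + x 0 * (1 + k * x 1)) * (1 + x 1 * (s * k * x 1 + s + k))]

/-!
Put `N = 1 + ∑ qᵢ`. A lattice point `(m, w)` lies in the cone over the simplex exactly when the
parameter `b = m - ∑ wᵢ` is nonnegative and `N wᵢ + b qᵢ ≥ 0` for all `i`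
(`latticePoint_mem_coneOver_iff`). Reflexivity amounts to `qᵢ ∣ N` for all `i`
(`isReflexivePolytope_of_mul_eq`, `dvd_of_isReflexivePolytope`). With `sᵢ = N / qᵢ` the lowest
lattice point with parameter `b` is `w = (-⌊b / sᵢ⌋)ᵢ`, at height `b - ∑ ⌊b / sᵢ⌋`, and the
integer decomposition property says that from each of these points one can split off a point of
height one, additively in all floors (`isIDP_of_exists_summand`, `IsIDP.exists_summand`). The
necessary condition says that the parameters `b = sᵢ` themselves have height one
(`necessaryCondition_iff_hasUnitHeight`), and it holds for reflexive simplices with the integer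
decomposition property because the point with `b = sᵢ` cannot be split.

For three weights with multiplicities `x₁, x₂, x₃` the necessary condition is solved from the top
down (`NecessaryCondition.isType`): `r₃ = 1 + x₁ r₁ + x₂ r₂`, then either `r₂ = 1 + x₁ r₁` or `r₂
= (1 + x₁ r₁)(1 + x₃)`, and finally a few cases for `r₁`. In terms of `sⱼ = N / rⱼ` one always
gets `s₃ = 1 + x₃` and `s₁ = t + x₁ L`, where `L = t r₁` is the least common multiple of `s₂` and
`s₃`, and either `s₂ = (1 + x₂) s₃` (types (i)–(iii)) or `s₂ = 1 + x₂ s₃` (types (iv)–(viii)). In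
types (i)–(vii), `t` is one of `1, s₃, s₂, L`. There a parameter `b = a s₁ + ρ` behaves with
respect to heights and to `s₂, s₃` like `a t + ρ`, so splittings for the two moduli `s₂, s₃` lift
as soon as they are compatible with the digits `a` and `ρ` (`exists_unit_summand_of_core`,
`core_of_dvd`, `core_of_coprime`). In type (viii), `t = (1 + s x₂) s₃` lies strictly between
consecutive multiples of `s₂`, and `b = x₁ L + (s + 1) s₂` has height `s + 1` but cannot be split
(`IsTypeVIII.not_isIDP`).
-/

/-! ### The cone over the simplex by its facet inequalities -/

/-- The polyhedral cone in `ℝ × ℝⁿ` cut out by the facets of the cone over `weightedSimplex q`. Up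
to the positive factor `N = 1 + ∑ qᵢ`, the quantity `m - ∑ vᵢ` is the coefficient of `(1, -q)`,
and `N vᵢ + (m - ∑ vᵢ) qᵢ` that of `(1, eᵢ)`, when `(m, v)` is expanded in the vertices. -/
def facetCone {n : ℕ} (q : Fin n → ℕ) : Set (ℝ × (Fin n → ℝ)) :=
  {z | 0 ≤ z.1 - ∑ i, z.2 i ∧
    ∀ i, 0 ≤ (1 + ∑ k, (q k : ℝ)) * z.2 i + (z.1 - ∑ k, z.2 k) * q i}

theorem facetCone_add {n : ℕ} {q : Fin n → ℕ} {y z : ℝ × (Fin n → ℝ)}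
    (hy : y ∈ facetCone q) (hz : z ∈ facetCone q) : y + z ∈ facetCone q := by
  refine ⟨?_, fun i => ?_⟩
  · have := add_nonneg hy.1 hz.1
    simp only [Prod.fst_add, Prod.snd_add, Pi.add_apply, Finset.sum_add_distrib]
    linarith
  · have := add_nonneg (hy.2 i) (hz.2 i)
    simp only [Prod.fst_add, Prod.snd_add, Pi.add_apply, Finset.sum_add_distrib]
    linarith

theorem facetCone_smul {n : ℕ} {q : Fin n → ℕ} {c : ℝ} (hc : 0 ≤ c) {z : ℝ × (Fin n → ℝ)}
    (hz : z ∈ facetCone q) : c • z ∈ facetCone q := by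
  refine ⟨?_, fun i => ?_⟩
  · have := mul_nonneg hc hz.1
    simp only [Prod.smul_fst, Prod.smul_snd, Pi.smul_apply, smul_eq_mul, ← Finset.mul_sum]
    linarith
  · have := mul_nonneg hc (hz.2 i)
    simp only [Prod.smul_fst, Prod.smul_snd, Pi.smul_apply, smul_eq_mul, ← Finset.mul_sum]
    linarith

theorem sum_cast_weights_nonneg {n : ℕ} (q : Fin n → ℕ) : (0 : ℝ) ≤ ∑ k, (q k : ℝ) :=
  Finset.sum_nonneg fun _ _ => Nat.cast_nonneg _

theorem mem_weightedSimplex_iff {n : ℕ} (q : Fin n → ℕ) (p : Fin n → ℝ) :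
    p ∈ weightedSimplex q ↔ ((1 : ℝ), p) ∈ facetCone q := by
  have hQ := sum_cast_weights_nonneg q
  constructor
  · intro hp
    have hconv : Convex ℝ {p : Fin n → ℝ | ((1 : ℝ), p) ∈ facetCone q} := by
      intro y hy z hz a b ha hb hab
      have h := facetCone_add (facetCone_smul ha hy) (facetCone_smul hb hz)
      simpa [hab] using h
    refine convexHull_min ?_ hconv hp
    rintro v (rfl | ⟨i, rfl⟩)
    · refine ⟨?_, fun i => ?_⟩
      · simp only [Finset.sum_neg_distrib]
        linarith
      · simp only [Finset.sum_neg_distrib]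
        exact le_of_eq (by ring)
    · refine ⟨by simp, fun j => ?_⟩
      simp only [Finset.sum_pi_single', Finset.mem_univ, if_true, sub_self, zero_mul, add_zero]
      exact mul_nonneg (by linarith)
        (by by_cases h : j = i <;> simp [h])
  · rintro ⟨h0, h1⟩
    have hN : (0 : ℝ) < 1 + ∑ k, (q k : ℝ) := by linarith
    obtain ⟨N, hNdef⟩ : ∃ N : ℝ, N = 1 + ∑ k, (q k : ℝ) := ⟨_, rfl⟩
    obtain ⟨t, ht⟩ : ∃ t : ℝ, t * N = 1 - ∑ k, p k :=
      ⟨(1 - ∑ k, p k) / N, div_mul_cancel₀ _ (by rw [hNdef]; exact hN.ne')⟩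
    simp only [← hNdef] at hN h1
    simp only at h0 h1
    rw [← ht] at h0 h1
    refine mem_convexHull_of_exists_fintype
      (fun o : Option (Fin n) => o.elim t fun i => p i + t * q i)
      (fun o : Option (Fin n) => o.elim (fun i => -(q i : ℝ)) fun i => Pi.single i 1)
      ?_ ?_ ?_ ?_
    · rintro (_ | i)
      · exact nonneg_of_mul_nonneg_left h0 hN
      · refine nonneg_of_mul_nonneg_left (b := N) ?_ hN
        have := h1 i
        simp only [Option.elim]
        linarith
    · simp only [Fintype.sum_option, Option.elim, Finset.sum_add_distrib, ← Finset.mul_sum]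
      rw [hNdef] at ht
      linarith
    · rintro (_ | i)
      · exact Set.mem_insert _ _
      · exact Set.mem_insert_of_mem _ ⟨i, rfl⟩
    · funext j
      simp [Fintype.sum_option, Finset.sum_apply, Pi.single_apply]

/-- Summed over all facets, the inequalities bound the height of a point of the cone. -/
theorem sub_sum_le_of_mem_facetCone {n : ℕ} {q : Fin n → ℕ} {z : ℝ × (Fin n → ℝ)}
    (hz : z ∈ facetCone q) : z.1 - ∑ i, z.2 i ≤ (1 + ∑ k, (q k : ℝ)) * z.1 := by
  have h := Finset.sum_nonneg fun i (_ : i ∈ Finset.univ) => hz.2 i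
  rw [Finset.sum_add_distrib, ← Finset.mul_sum, ← Finset.mul_sum] at h
  linarith

theorem coneOver_weightedSimplex {n : ℕ} (q : Fin n → ℕ) :
    coneOver (weightedSimplex q) = facetCone q := by
  have hQ := sum_cast_weights_nonneg q
  ext ⟨m, v⟩
  constructor
  · intro h
    refine Submodule.span_induction (p := fun z _ => z ∈ facetCone q) ?_ ?_ ?_ ?_ h
    · rintro _ ⟨p, hp, rfl⟩
      exact (mem_weightedSimplex_iff q p).1 hp
    · exact ⟨by simp, by simp⟩
    · intro y z _ _ hy hz
      exact facetCone_add hy hz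
    · intro c z _ hz
      exact facetCone_smul c.2 hz
  · intro h
    have hm : 0 ≤ m := nonneg_of_mul_nonneg_right
      (h.1.trans (sub_sum_le_of_mem_facetCone h)) (by linarith)
    rcases hm.eq_or_lt with hm | hm
    · -- the cone has no nonzero point at height `0`
      subst hm
      have h2 := sub_sum_le_of_mem_facetCone h
      have h1 := h.1
      simp only [mul_zero] at h2 h1
      have hs : ∑ i, v i = 0 := by linarith
      have hv : ∀ i, 0 ≤ v i := fun i => by
        have := h.2 i
        simp only [hs, sub_zero, zero_mul, add_zero] at this
        exact nonneg_of_mul_nonneg_right this (by linarith)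
      have hv0 : v = 0 := by
        funext i
        exact (Finset.sum_eq_zero_iff_of_nonneg fun i _ => hv i).1 hs i (Finset.mem_univ i)
      rw [hv0]
      exact Submodule.zero_mem _
    · have hp : (m⁻¹ • v) ∈ weightedSimplex q := by
        rw [mem_weightedSimplex_iff]
        have := facetCone_smul (inv_nonneg.2 hm.le) h
        simpa [hm.ne'] using this
      have := Submodule.smul_mem (PointedCone.hull ℝ
        ((fun p : Fin n → ℝ => ((1 : ℝ), p)) '' weightedSimplex q)) (⟨m, hm.le⟩ : {c : ℝ // 0 ≤ c})
        (Submodule.subset_span ⟨_, hp, rfl⟩)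
      have h3 : (⟨m, hm.le⟩ : {c : ℝ // 0 ≤ c}) • ((1 : ℝ), m⁻¹ • v) = (m, v) := by
        change m • ((1 : ℝ), m⁻¹ • v) = (m, v)
        simp [smul_smul, hm.ne']
      rw [h3] at this
      exact this

/-- For positive weights the interior of the cone is given by the strict facet inequalities: all
facet functionals are positive on `(1, 0)`, so moving an interior point a little against that
direction shows that none of them vanishes there. -/
theorem mem_interior_facetCone_iff {n : ℕ} {q : Fin n → ℕ} (hq : ∀ i, 0 < q i)
    (z : ℝ × (Fin n → ℝ)) :
    z ∈ interior (facetCone q) ↔ 0 < z.1 - ∑ i, z.2 i ∧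
      ∀ i, 0 < (1 + ∑ k, (q k : ℝ)) * z.2 i + (z.1 - ∑ k, z.2 k) * q i := by
  constructor
  · intro hz
    have hcont : Continuous fun e : ℝ => z - e • ((1 : ℝ), (0 : Fin n → ℝ)) := by fun_prop
    have hnear : ∀ᶠ e in nhds (0 : ℝ), z - e • ((1 : ℝ), (0 : Fin n → ℝ)) ∈ facetCone q := by
      refine hcont.continuousAt.eventually_mem ?_
      simpa using mem_interior_iff_mem_nhds.1 hz
    obtain ⟨e, hmem, he⟩ := ((hnear.filter_mono nhdsWithin_le_nhds).and
      (self_mem_nhdsWithin (s := Set.Ioi (0 : ℝ)))).exists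
    have he : 0 < e := he
    refine ⟨?_, fun i => ?_⟩
    · have := hmem.1
      simp at this
      linarith
    · have h1 := hmem.2 i
      have h2 : 0 < e * q i := mul_pos he (by exact_mod_cast hq i)
      simp at h1
      linarith
  · rintro ⟨h0, h1⟩
    have hopen : IsOpen {z : ℝ × (Fin n → ℝ) | 0 < z.1 - ∑ i, z.2 i ∧
        ∀ i, 0 < (1 + ∑ k, (q k : ℝ)) * z.2 i + (z.1 - ∑ k, z.2 k) * q i} := by
      simp only [Set.ofPred_and, Set.ofPred_forall]
      refine (isOpen_lt (by fun_prop) (by fun_prop)).inter (isOpen_iInter_of_finite fun i => ?_)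
      exact isOpen_lt (by fun_prop) (by fun_prop)
    refine mem_interior.2 ⟨_, ?_, hopen, ⟨h0, h1⟩⟩
    exact fun z hz => ⟨hz.1.le, fun i => (hz.2 i).le⟩

/-! ### Lattice points of the cone -/

theorem latticePoint_mem_coneOver_iff {n : ℕ} (q : Fin n → ℕ) (m : ℤ) (w : Fin n → ℤ) :
    ((m : ℝ), latticePoint w) ∈ coneOver (weightedSimplex q) ↔
      0 ≤ m - ∑ i, w i ∧ ∀ i, 0 ≤ (1 + ∑ k, (q k : ℤ)) * w i + (m - ∑ k, w k) * q i := by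
  rw [coneOver_weightedSimplex]
  simp only [facetCone, latticePoint, Set.mem_ofPred_eq]
  norm_cast

theorem latticePoint_mem_interior_coneOver_iff {n : ℕ} {q : Fin n → ℕ} (hq : ∀ i, 0 < q i)
    (m : ℤ) (w : Fin n → ℤ) :
    ((m : ℝ), latticePoint w) ∈ interior (coneOver (weightedSimplex q)) ↔
      0 < m - ∑ i, w i ∧ ∀ i, 0 < (1 + ∑ k, (q k : ℤ)) * w i + (m - ∑ k, w k) * q i := by
  rw [coneOver_weightedSimplex, mem_interior_facetCone_iff hq]
  simp only [latticePoint]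
  norm_cast

theorem latticePoint_mem_weightedSimplex_iff {n : ℕ} (q : Fin n → ℕ) (w : Fin n → ℤ) :
    latticePoint w ∈ weightedSimplex q ↔
      (((1 : ℤ) : ℝ), latticePoint w) ∈ coneOver (weightedSimplex q) := by
  rw [mem_weightedSimplex_iff, coneOver_weightedSimplex, Int.cast_one]

theorem zero_mem_interior_weightedSimplex {n : ℕ} {q : Fin n → ℕ} (hq : ∀ i, 0 < q i) :
    latticePoint (0 : Fin n → ℤ) ∈ interior (weightedSimplex q) := by
  have hsub : (fun p : Fin n → ℝ => ((1 : ℝ), p)) ⁻¹' interior (facetCone q) ⊆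
      weightedSimplex q := fun p hp => (mem_weightedSimplex_iff q p).2 (interior_subset hp)
  refine interior_maximal hsub (isOpen_interior.preimage (by fun_prop)) ?_
  rw [Set.mem_preimage, mem_interior_facetCone_iff hq]
  exact ⟨by simp [latticePoint], fun i => by simpa [latticePoint] using hq i⟩

/-! ### Reflexivity and divisibility -/

/-- If `qᵢ sᵢ = N` for all `i`, the facet inequalities can be divided by the `qᵢ`. -/
theorem latticePoint_mem_coneOver_iff_of_mul_eq {n : ℕ} {q s : Fin n → ℕ}
    (hs : ∀ i, s i * q i = 1 + ∑ k, q k) (m : ℤ) (w : Fin n → ℤ) :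
    ((m : ℝ), latticePoint w) ∈ coneOver (weightedSimplex q) ↔
      0 ≤ m - ∑ i, w i ∧ ∀ i, 0 ≤ (s i : ℤ) * w i + (m - ∑ k, w k) := by
  rw [latticePoint_mem_coneOver_iff]
  refine and_congr_right fun _ => forall_congr' fun i => ?_
  have hq : 0 < q i := Nat.pos_of_ne_zero fun h => by have := hs i; simp [h] at this; omega
  have h : (1 + ∑ k, (q k : ℤ)) * w i + (m - ∑ k, w k) * q i =
      q i * (s i * w i + (m - ∑ k, w k)) := by
    have : (1 + ∑ k, (q k : ℤ)) = s i * q i := by exact_mod_cast (hs i).symm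
    rw [this]
    ring
  rw [h]
  exact mul_nonneg_iff_of_pos_left (by exact_mod_cast hq)

theorem isReflexivePolytope_of_mul_eq {n : ℕ} {q s : Fin n → ℕ}
    (hs : ∀ i, s i * q i = 1 + ∑ k, q k) : IsReflexivePolytope (weightedSimplex q) := by
  have hq : ∀ i, 0 < q i := fun i =>
    Nat.pos_of_ne_zero fun h => by have := hs i; simp [h] at this; omega
  refine ⟨0, zero_mem_interior_weightedSimplex hq, fun m w => ?_⟩
  rw [latticePoint_mem_interior_coneOver_iff hq, latticePoint_mem_coneOver_iff_of_mul_eq hs,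
    sub_zero]
  refine and_congr (by omega) (forall_congr' fun i => ?_)
  have h : (1 + ∑ k, (q k : ℤ)) * w i + (m - ∑ k, w k) * q i =
      q i * (s i * w i + (m - ∑ k, w k)) := by
    have : (1 + ∑ k, (q k : ℤ)) = s i * q i := by exact_mod_cast (hs i).symm
    rw [this]
    ring
  rw [h, mul_pos_iff_of_pos_left (by exact_mod_cast hq i)]
  omega

/-- The lattice point `c` in the definition of reflexivity must be the origin. An interior lattice
point whose `i`-th facet functional takes the value `gcd (N, qᵢ)` remains in the cone after
subtraction of `(1, 0)`, where the value is `gcd (N, qᵢ) - qᵢ`; hence `qᵢ ≤ gcd (N, qᵢ)`. -/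
theorem dvd_of_isReflexivePolytope {n : ℕ} {q : Fin n → ℕ} (hq : ∀ i, 0 < q i)
    (h : IsReflexivePolytope (weightedSimplex q)) (i : Fin n) : q i ∣ 1 + ∑ k, q k := by
  obtain ⟨c, -, hc⟩ := h
  obtain ⟨N, hN⟩ : ∃ N : ℤ, N = 1 + ∑ k, (q k : ℤ) := ⟨_, rfl⟩
  have hNpos : 0 < N := by
    have : (0 : ℤ) ≤ ∑ k, (q k : ℤ) := Finset.sum_nonneg fun _ _ => Nat.cast_nonneg _
    omega
  -- the interior point `(1, 0)` must be a translate by `(1, c)`, which forces `c = 0`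
  have hc0 : c = 0 := by
    have h1 := (hc 1 0).1 ((latticePoint_mem_interior_coneOver_iff hq 1 0).2
      ⟨by simp, fun i => by simpa using hq i⟩)
    rw [latticePoint_mem_coneOver_iff] at h1
    simp only [zero_sub, Pi.neg_apply, Finset.sum_neg_distrib, sub_self, neg_neg, ← hN] at h1
    obtain ⟨h1, h2⟩ := h1
    have h3 := Finset.sum_nonneg fun k (_ : k ∈ Finset.univ) => h2 k
    rw [Finset.sum_add_distrib, ← Finset.mul_sum, ← Finset.mul_sum, Finset.sum_neg_distrib,
      show ∑ k, (q k : ℤ) = N - 1 by omega] at h3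
    have h4 : ∑ k, c k = 0 := by linarith
    have h5 : ∀ k, c k ≤ 0 := fun k => by
      have := h2 k
      rw [h4, zero_mul, add_zero] at this
      linarith [nonneg_of_mul_nonneg_right this hNpos]
    funext k
    exact (Finset.sum_eq_zero_iff_of_nonpos fun k _ => h5 k).1 h4 k (Finset.mem_univ k)
  subst hc0
  -- a Bézout representation of `gcd (N, qᵢ)` with positive coefficient at `qᵢ`
  obtain ⟨u, b, hb, hgcd⟩ : ∃ u b : ℤ, 0 < b ∧ N * u + b * q i = Int.gcd N (q i) := by
    have h1 := Int.gcd_eq_gcd_ab N (q i)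
    obtain ⟨l, hl⟩ : ∃ l : ℤ, 0 < Int.gcdB N (q i) + l * N :=
      ⟨|Int.gcdB N (q i)| + 1, by
        nlinarith [neg_abs_le (Int.gcdB N (q i)), abs_nonneg (Int.gcdB N (q i))]⟩
    exact ⟨Int.gcdA N (q i) - l * q i, _, hl, by rw [h1]; ring⟩
  have hqi : (0 : ℤ) < q i := by exact_mod_cast hq i
  have hgpos : (0 : ℤ) < Int.gcd N (q i) := by
    exact_mod_cast Int.gcd_pos_of_ne_zero_left _ hNpos.ne'
  obtain ⟨w, hw⟩ : ∃ w : Fin n → ℤ, w = Function.update (0 : Fin n → ℤ) i u := ⟨_, rfl⟩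
  have hwi : w i = u := by simp [hw]
  have hint := (hc (b + ∑ k, w k) w).1 ((latticePoint_mem_interior_coneOver_iff hq _ w).2
    ⟨by simpa using hb, fun k => by
      rw [add_sub_cancel_right, ← hN]
      by_cases hk : k = i
      · rw [hk, hwi, hgcd]
        exact hgpos
      · rw [hw, Function.update_of_ne hk, Pi.zero_apply, mul_zero, zero_add]
        exact mul_pos hb (by exact_mod_cast hq k)⟩)
  rw [sub_zero, latticePoint_mem_coneOver_iff, ← hN] at hint
  have h1 := hint.2 i
  rw [hwi, show (b + ∑ k, w k - 1 - ∑ k, w k) = b - 1 by ring, sub_mul, one_mul] at h1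
  have hle : (q i : ℤ) ≤ Int.gcd N (q i) := by linarith
  have hdvd : (Int.gcd N (q i) : ℤ) ∣ q i := Int.gcd_dvd_right ..
  have heq : (Int.gcd N (q i) : ℤ) = q i := le_antisymm (Int.le_of_dvd hqi hdvd) hle
  have : (q i : ℤ) ∣ N := heq ▸ Int.gcd_dvd_left ..
  rw [hN] at this
  exact_mod_cast this

/-! ### The integer decomposition property in terms of one integer parameter -/

/-- Sufficient condition for the integer decomposition property. For each `b` the lowest lattice
point of the cone with `m - ∑ wᵢ = b` is `w = (-⌊b / sᵢ⌋)ᵢ`; the hypothesis says that a lattice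
point of the simplex, with parameter `c`, can be subtracted from it without leaving the cone. -/
theorem isIDP_of_exists_summand {n : ℕ} {q s : Fin n → ℕ}
    (hs : ∀ i, s i * q i = 1 + ∑ k, q k)
    (h : ∀ b, 0 < b → b < 1 + ∑ k, q k →
      ∃ c ≤ b, c = 1 + ∑ i, c / s i ∧ ∀ i, c / s i + (b - c) / s i = b / s i) :
    IsIDP (weightedSimplex q) := by
  have hspos : ∀ i, 0 < s i := fun i =>
    Nat.pos_of_ne_zero fun h => by have := hs i; simp [h] at this; omega
  -- for `b ≥ N` the vertex `(1, -q)` can be subtracted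
  have h' : ∀ b, 0 < b →
      ∃ c ≤ b, c = 1 + ∑ i, c / s i ∧ ∀ i, c / s i + (b - c) / s i = b / s i := by
    intro b hb
    by_cases hbN : b < 1 + ∑ k, q k
    · exact h b hb hbN
    · have hdiv : ∀ i, (1 + ∑ k, q k) / s i = q i := fun i => by
        rw [← hs i, Nat.mul_div_cancel_left _ (hspos i)]
      refine ⟨1 + ∑ k, q k, by omega, by simp only [hdiv], fun i => ?_⟩
      obtain ⟨e, rfl⟩ := Nat.exists_eq_add_of_le (not_lt.1 hbN)
      rw [Nat.add_sub_cancel_left, hdiv, ← hs i, Nat.mul_add_div (hspos i)]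
  have mem := latticePoint_mem_coneOver_iff_of_mul_eq hs
  have step : ∀ (m : ℕ) (w : Fin n → ℤ),
      ((((m + 1 : ℕ) : ℤ) : ℝ), latticePoint w) ∈ coneOver (weightedSimplex q) →
      ∃ p : Fin n → ℤ, (((1 : ℤ) : ℝ), latticePoint p) ∈ coneOver (weightedSimplex q) ∧
        (((m : ℤ) : ℝ), latticePoint (w - p)) ∈ coneOver (weightedSimplex q) := by
    intro m w hw
    rw [mem] at hw
    obtain ⟨b, hb⟩ := Int.eq_ofNat_of_zero_le hw.1
    rw [hb] at hw
    obtain ⟨-, hw⟩ := hw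
    have hfl : ∀ i, 0 ≤ w i + ((b / s i : ℕ) : ℤ) := fun i => by
      have h1 : -w i ≤ (b : ℤ) / s i :=
        (Int.le_ediv_iff_mul_le (by exact_mod_cast hspos i)).2 (by linarith [hw i])
      push_cast
      linarith
    by_cases hex : ∃ i, 0 < w i + ((b / s i : ℕ) : ℤ)
    · -- above the lowest point with parameter `b`, a vertex `(1, eᵢ)` can be subtracted
      obtain ⟨i, hi⟩ := hex
      have hsum : ∑ k, (w - Pi.single i 1 : Fin n → ℤ) k = ∑ k, w k - 1 := by
        simp [Finset.sum_sub_distrib]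
      refine ⟨Pi.single i 1, ?_, ?_⟩
      · rw [mem]
        refine ⟨by simp, fun k => ?_⟩
        by_cases hk : k = i <;> simp [hk]
      · rw [mem, hsum]
        push_cast at hb
        refine ⟨by omega, fun k => ?_⟩
        rw [show (m : ℤ) - (∑ k, w k - 1) = b by omega]
        by_cases hk : k = i
        · subst hk
          have h1 : (1 - w k) ≤ (b : ℤ) / s k := by push_cast at hi; omega
          have := (Int.le_ediv_iff_mul_le (by exact_mod_cast hspos k)).1 h1
          simp only [Pi.sub_apply, Pi.single_eq_same]
          linarith
        · simpa [hk] using hw k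
    · push Not at hex
      have hweq : ∀ i, w i = -((b / s i : ℕ) : ℤ) := fun i => by
        have := hfl i
        have := hex i
        omega
      have hbpos : 0 < b := by
        rcases Nat.eq_zero_or_pos b with rfl | h0
        · simp [hweq] at hb
          omega
        · exact h0
      obtain ⟨c, hcb, hc1, hcs⟩ := h' b hbpos
      have hsum : ∑ k, -((c / s k : ℕ) : ℤ) = 1 - c := by
        rw [Finset.sum_neg_distrib]
        have : (c : ℤ) = 1 + ∑ k, ((c / s k : ℕ) : ℤ) := by exact_mod_cast hc1
        omega
      have hle : ∀ a k : ℕ, 0 < k → (0 : ℤ) ≤ k * -((a / k : ℕ) : ℤ) + a := fun a k hk => by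
        have : k * (a / k) ≤ a := Nat.mul_div_le a k
        have : (k : ℤ) * ((a / k : ℕ) : ℤ) ≤ a := by exact_mod_cast this
        linarith
      refine ⟨fun k => -((c / s k : ℕ) : ℤ), ?_, ?_⟩
      · rw [mem, hsum]
        refine ⟨by omega, fun k => ?_⟩
        rw [sub_sub_cancel]
        exact hle c (s k) (hspos k)
      · have hdiff : w - (fun k => -((c / s k : ℕ) : ℤ)) =
            fun k => -(((b - c) / s k : ℕ) : ℤ) := by
          funext k
          rw [Pi.sub_apply, hweq, ← hcs k]
          push_cast
          ring
        have hsum' : (m : ℤ) - ∑ k, (w - (fun k => -((c / s k : ℕ) : ℤ))) k =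
            ((b - c : ℕ) : ℤ) := by
          simp only [Pi.sub_apply, Finset.sum_sub_distrib, hsum]
          push_cast [hcb] at hb ⊢
          omega
        rw [mem, hsum', hdiff]
        exact ⟨Int.natCast_nonneg _, fun k => hle (b - c) (s k) (hspos k)⟩
  have key : ∀ (m : ℕ) (w : Fin n → ℤ),
      ((((m + 1 : ℕ) : ℤ) : ℝ), latticePoint w) ∈ coneOver (weightedSimplex q) →
      ∃ p : Fin (m + 1) → (Fin n → ℤ),
        (∀ k, latticePoint (p k) ∈ weightedSimplex q) ∧ w = ∑ k, p k := by
    intro m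
    induction m with
    | zero =>
      intro w hw
      refine ⟨fun _ => w, fun _ => ?_, by simp⟩
      rw [latticePoint_mem_weightedSimplex_iff]
      simpa using hw
    | succ m ih =>
      intro w hw
      obtain ⟨p, hp, hrest⟩ := step _ w hw
      obtain ⟨p', hp', hsum⟩ := ih _ hrest
      refine ⟨Fin.cons p p', fun k => ?_, ?_⟩
      · refine Fin.cases ?_ (fun k => ?_) k
        · simpa [latticePoint_mem_weightedSimplex_iff] using hp
        · simpa using hp' k
      · rw [Fin.sum_univ_succ]
        simp [← hsum]
  intro m hm w hw
  obtain ⟨m, rfl⟩ := Nat.exists_eq_succ_of_ne_zero hm.ne'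
  exact key m w (by exact_mod_cast hw)

/-- Necessary condition for the integer decomposition property: decompose the lowest lattice point
`w = (-⌊b / sᵢ⌋)ᵢ` with parameter `b`. Some summand has a negative `i₀`-th coordinate, so its
parameter `c` is at least `s_{i₀}`, and lowness of `w` forces the floors to be additive. -/
theorem IsIDP.exists_summand {n : ℕ} {q s : Fin n → ℕ}
    (hs : ∀ i, s i * q i = 1 + ∑ k, q k) (h : IsIDP (weightedSimplex q)) {b : ℕ}
    (hb : 1 + ∑ i, b / s i ≤ b) {i₀ : Fin n} (hi₀ : s i₀ ≤ b) :
    ∃ c ≤ b, s i₀ ≤ c ∧ c = 1 + ∑ i, c / s i ∧ ∀ i, c / s i + (b - c) / s i = b / s i := by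
  have hspos : ∀ i, 0 < s i := fun i =>
    Nat.pos_of_ne_zero fun h => by have := hs i; simp [h] at this; omega
  have mem := latticePoint_mem_coneOver_iff_of_mul_eq hs
  obtain ⟨m, hm⟩ := Nat.exists_eq_add_of_le hb
  obtain ⟨w, hw⟩ : ∃ w : Fin n → ℤ, w = fun i => -((b / s i : ℕ) : ℤ) := ⟨_, rfl⟩
  have hwsum : ((1 + m : ℕ) : ℤ) - ∑ k, w k = b := by
    simp only [hw, Finset.sum_neg_distrib]
    have : (b : ℤ) = 1 + ∑ i, ((b / s i : ℕ) : ℤ) + m := by exact_mod_cast hm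
    push_cast at this ⊢
    omega
  obtain ⟨p, hp, hsum⟩ := h (1 + m) (by omega) w (by
    have := (mem (1 + m : ℕ) w).2 ⟨by rw [hwsum]; positivity, fun i => by
      rw [hwsum, hw]
      have : s i * (b / s i) ≤ b := Nat.mul_div_le b (s i)
      have : (s i : ℤ) * ((b / s i : ℕ) : ℤ) ≤ b := by exact_mod_cast this
      linarith⟩
    exact_mod_cast this)
  have hp : ∀ k, 0 ≤ 1 - ∑ i, p k i ∧ ∀ i, 0 ≤ (s i : ℤ) * p k i + (1 - ∑ j, p k j) := fun k =>
    (mem 1 (p k)).1 ((latticePoint_mem_weightedSimplex_iff q _).1 (hp k))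
  obtain ⟨k, hk⟩ : ∃ k, p k i₀ < 0 := by
    by_contra! hcon
    have h1 : w i₀ = ∑ k, p k i₀ := by rw [hsum, Finset.sum_apply]
    have h2 : 0 ≤ w i₀ := h1 ▸ Finset.sum_nonneg fun k _ => hcon k
    have h3 : 0 < b / s i₀ := Nat.div_pos hi₀ (hspos i₀)
    rw [hw] at h2
    simp only at h2
    omega
  obtain ⟨c, hc⟩ := Int.eq_ofNat_of_zero_le (hp k).1
  -- the remaining summands add up to a lattice point with parameter `b - c`
  have hrest : ∀ (f : (Fin n → ℤ) →+ ℤ), f (w - p k) = ∑ l ∈ Finset.univ.erase k, f (p l) := by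
    intro f
    rw [map_sub, hsum, map_sum, ← Finset.sum_erase_add _ _ (Finset.mem_univ k),
      add_sub_cancel_right]
  have hrestb : (b : ℤ) - c = ∑ l ∈ Finset.univ.erase k, (1 - ∑ i, p l i) := by
    rw [← hc, Finset.sum_sub_distrib, ← hwsum, hsum]
    have h1 : ∑ i, (∑ l, p l) i = ∑ l, ∑ i, p l i := by
      simp only [Finset.sum_apply]
      exact Finset.sum_comm
    rw [h1, ← Finset.sum_erase_add _ _ (Finset.mem_univ k)]
    simp
    ring
  have hcb : c ≤ b := by
    have : 0 ≤ (b : ℤ) - c := hrestb ▸ Finset.sum_nonneg fun l _ => (hp l).1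
    omega
  have hrestw : ∀ i, 0 ≤ (s i : ℤ) * (w i - p k i) + ((b - c : ℕ) : ℤ) := fun i => by
    have h1 : w i - p k i = ∑ l ∈ Finset.univ.erase k, p l i :=
      hrest (Pi.evalAddMonoidHom (fun _ => ℤ) i)
    push_cast [hcb]
    rw [hrestb, h1, Finset.mul_sum, ← Finset.sum_add_distrib]
    exact Finset.sum_nonneg fun l _ => (hp l).2 i
  have hpk := (hp k).2
  rw [hc] at hpk
  have hfl : ∀ i (a : ℕ) (v : ℤ), 0 ≤ (s i : ℤ) * v + a → -v ≤ ((a / s i : ℕ) : ℤ) := by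
    intro i a v hv
    push_cast
    exact (Int.le_ediv_iff_mul_le (by exact_mod_cast hspos i)).2 (by linarith)
  have hadd : ∀ i, c / s i + (b - c) / s i ≤ b / s i := fun i => by
    have h1 : c / s i + (b - c) / s i ≤ (c + (b - c)) / s i := Nat.div_add_div_le_add_div
    rwa [Nat.add_sub_cancel' hcb] at h1
  have heq : ∀ i, p k i = -((c / s i : ℕ) : ℤ) ∧ c / s i + (b - c) / s i = b / s i := fun i => by
    have h1 := hfl i c (p k i) (hpk i)
    have h2 := hfl i (b - c) (w i - p k i) (hrestw i)
    have h3 := hadd i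
    rw [hw] at h2
    simp only at h2
    omega
  refine ⟨c, hcb, ?_, ?_, fun i => (heq i).2⟩
  · have h1 := (heq i₀).1
    have h2 : 1 ≤ c / s i₀ := by omega
    simpa using (Nat.le_div_iff_mul_le (hspos i₀)).1 h2
  · have h1 : ∑ i, p k i = -∑ i, ((c / s i : ℕ) : ℤ) := by
      rw [← Finset.sum_neg_distrib]
      exact Finset.sum_congr rfl fun i _ => (heq i).1
    rw [h1] at hc
    zify
    push_cast at hc
    linarith

/-! ### Weight vectors with repeated entries -/

/-- In the weighted simplex with support vector `r` and multiplicities `x`, where `S j = N / r j`,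
the lowest lattice point `-⌊c / S⌋` of the cone with parameter `c` has height `c - ∑ xⱼ ⌊c / Sⱼ⌋`.
This predicate says that the height is one, that is, that the lattice point lies in the simplex.
-/
def HasUnitHeight {d : ℕ} (S x : Fin d → ℕ) (c : ℕ) : Prop :=
  c = 1 + ∑ j, x j * (c / S j)

theorem sum_comp_weightVector {d : ℕ} (r x : Fin d → ℕ) (f : ℕ → ℕ) :
    ∑ i, f (weightVector r x i) = ∑ j, x j * f (r j) := by
  unfold weightVector
  rw [Equiv.sum_comp finSigmaFinEquiv.symm fun p : (j : Fin d) × Fin (x j) => f (r p.1),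
    Fintype.sum_sigma]
  simp

theorem sum_weightVector {d : ℕ} (r x : Fin d → ℕ) :
    ∑ i, weightVector r x i = ∑ j, x j * r j :=
  sum_comp_weightVector r x id

theorem exists_weightVector_eq {d : ℕ} {x : Fin d → ℕ} (hx : ∀ j, 0 < x j) (j : Fin d) :
    ∃ i, ∀ r : Fin d → ℕ, weightVector r x i = r j :=
  ⟨finSigmaFinEquiv ⟨j, ⟨0, hx j⟩⟩, fun r => by simp [weightVector]⟩

theorem weightVector_mul_eq {d : ℕ} {r x S : Fin d → ℕ}
    (hS : ∀ j, S j * r j = 1 + ∑ i, x i * r i) (i : Fin (∑ j, x j)) :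
    weightVector S x i * weightVector r x i = 1 + ∑ k, weightVector r x k := by
  rw [sum_weightVector]
  exact hS _

theorem isIDP_weightVector {d : ℕ} {r x S : Fin d → ℕ}
    (hS : ∀ j, S j * r j = 1 + ∑ i, x i * r i)
    (h : ∀ b, 0 < b → b < 1 + ∑ i, x i * r i →
      ∃ c e, b = c + e ∧ HasUnitHeight S x c ∧ ∀ j, (c + e) / S j = c / S j + e / S j) :
    IsIDP (weightedSimplex (weightVector r x)) := by
  refine isIDP_of_exists_summand (weightVector_mul_eq hS) fun b hb hbN => ?_
  rw [sum_weightVector] at hbN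
  obtain ⟨c, e, rfl, hc, hadd⟩ := h b hb hbN
  refine ⟨c, Nat.le_add_right c e, ?_, fun i => ?_⟩
  · rw [sum_comp_weightVector S x fun s => c / s]
    exact hc
  · rw [Nat.add_sub_cancel_left]
    exact (hadd _).symm

theorem exists_summand_of_isIDP {d : ℕ} {r x S : Fin d → ℕ} (hx : ∀ j, 0 < x j)
    (hS : ∀ j, S j * r j = 1 + ∑ i, x i * r i)
    (h : IsIDP (weightedSimplex (weightVector r x))) {b : ℕ}
    (hb : 1 + ∑ j, x j * (b / S j) ≤ b) {j₀ : Fin d} (hj₀ : S j₀ ≤ b) :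
    ∃ c e, b = c + e ∧ S j₀ ≤ c ∧ HasUnitHeight S x c ∧
      ∀ j, (c + e) / S j = c / S j + e / S j := by
  obtain ⟨i₀, hi₀⟩ := exists_weightVector_eq hx j₀
  obtain ⟨c, hcb, hc0, hc1, hadd⟩ := h.exists_summand (weightVector_mul_eq hS) (b := b) (i₀ := i₀)
    (by rwa [sum_comp_weightVector S x fun s => b / s]) (by rwa [hi₀])
  refine ⟨c, b - c, by omega, by rwa [hi₀] at hc0, ?_, fun j => ?_⟩
  · rwa [sum_comp_weightVector S x fun s => c / s] at hc1
  · obtain ⟨i, hi⟩ := exists_weightVector_eq hx j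
    have := hadd i
    rw [hi] at this
    rw [this, Nat.add_sub_cancel' hcb]

theorem div_eq_div_of_mul_eq_mul {a b c d : ℕ} (hb : 0 < b) (hc : 0 < c) (h : a * c = b * d) :
    a / b = d / c := by
  rw [← Nat.mul_div_mul_right a b hc, h, Nat.mul_div_mul_left d c hb]

/-- The difference between `1 + ∑ xᵢ (rᵢ mod rⱼ)` and `rⱼ` is `rⱼ` times the difference between the
height of the lattice point with parameter `Sⱼ` and one. -/
theorem one_add_sum_mod_eq {d : ℕ} {r x S : Fin d → ℕ}
    (hS : ∀ j, S j * r j = 1 + ∑ i, x i * r i) (j : Fin d) :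
    1 + ∑ i, x i * (r i % r j) + r j * ∑ i, x i * (S j / S i) = r j * S j := by
  have hpos : ∀ i, 0 < S i ∧ 0 < r i := fun i =>
    ⟨Nat.pos_of_ne_zero fun h => by have := hS i; simp [h] at this; omega,
      Nat.pos_of_ne_zero fun h => by have := hS i; simp [h] at this; omega⟩
  rw [mul_comm (r j) (S j), hS j, Finset.mul_sum, add_assoc, ← Finset.sum_add_distrib]
  congr 1
  refine Finset.sum_congr rfl fun i _ => ?_
  rw [div_eq_div_of_mul_eq_mul (hpos i).1 (hpos j).2 ((hS j).trans (hS i).symm)]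
  conv_rhs => rw [← Nat.mod_add_div (r i) (r j)]
  ring

theorem necessaryCondition_iff_hasUnitHeight {d : ℕ} {r x S : Fin d → ℕ}
    (hS : ∀ j, S j * r j = 1 + ∑ i, x i * r i) :
    NecessaryCondition r x ↔ ∀ j, HasUnitHeight S x (S j) := by
  refine forall_congr' fun j => ?_
  have h := one_add_sum_mod_eq hS j
  have hr : 0 < r j := Nat.pos_of_ne_zero fun h => by have := hS j; simp [h] at this; omega
  unfold HasUnitHeight
  constructor
  · intro h1
    rw [h1] at h
    refine Nat.eq_of_mul_eq_mul_left hr ?_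
    rw [← h]
    ring
  · intro h1
    have h2 : r j * S j = r j + r j * ∑ i, x i * (S j / S i) := by
      conv_lhs => rw [h1]
      ring
    omega

/-- A reflexive simplex with the integer decomposition property satisfies the necessary condition:
a summand of the lattice point with parameter `Sⱼ` whose `j`-th coordinate is negative has
parameter at least `Sⱼ`, so it is the whole point. -/
theorem necessaryCondition_of_isReflexivePolytope_of_isIDP {d : ℕ} {r x : Fin d → ℕ}
    (hr : ∀ j, 0 < r j) (hx : ∀ j, 0 < x j)
    (hrefl : IsReflexivePolytope (weightedSimplex (weightVector r x)))
    (hidp : IsIDP (weightedSimplex (weightVector r x))) : NecessaryCondition r x := by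
  have hdvd : ∀ j, r j ∣ 1 + ∑ i, x i * r i := fun j => by
    obtain ⟨i, hi⟩ := exists_weightVector_eq hx j
    have := dvd_of_isReflexivePolytope (q := weightVector r x) (fun i => hr _) hrefl i
    rwa [hi, sum_weightVector] at this
  choose S hS using hdvd
  have hS : ∀ j, S j * r j = 1 + ∑ i, x i * r i := fun j => by rw [hS j, mul_comm]
  rw [necessaryCondition_iff_hasUnitHeight hS]
  intro j
  obtain ⟨c, e, hce, hjc, hc, -⟩ := exists_summand_of_isIDP hx hS hidp (b := S j) (j₀ := j) (by
    have h := one_add_sum_mod_eq hS j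
    have h1 : r j * ∑ i, x i * (S j / S i) < r j * S j := by omega
    have := lt_of_mul_lt_mul_left h1 (Nat.zero_le _)
    omega) le_rfl
  have : c = S j := by omega
  rwa [this] at hc

/-! ### Additive splittings at the two smaller moduli -/

/-- For the two moduli `s₂, s₃` with multiplicities `x₂, x₃`: the parameter `c` has height one,
and the floors of `c + e` at both moduli are the sums of those of `c` and `e`. -/
def IsUnitSummand (x₂ x₃ s₂ s₃ c e : ℕ) : Prop :=
  c = 1 + x₂ * (c / s₂) + x₃ * (c / s₃) ∧
    (c + e) / s₂ = c / s₂ + e / s₂ ∧ (c + e) / s₃ = c / s₃ + e / s₃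

theorem add_div_of_mod_lt {s c e : ℕ} (h : c % s + e % s < s) : (c + e) / s = c / s + e / s := by
  rw [Nat.add_div (by omega), if_neg (by omega), add_zero]

theorem isUnitSummand_one {x₂ x₃ s₂ s₃ e : ℕ} (h : s₃ < s₂) (he : 1 + e < s₃) :
    IsUnitSummand x₂ x₃ s₂ s₃ 1 e := by
  refine ⟨?_, ?_, ?_⟩
  · rw [Nat.div_eq_of_lt (by omega), Nat.div_eq_of_lt (by omega), mul_zero, mul_zero]
    rfl
  · rw [Nat.div_eq_of_lt (by omega), Nat.div_eq_of_lt (by omega), Nat.div_eq_of_lt (by omega)]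
  · rw [Nat.div_eq_of_lt (by omega), Nat.div_eq_of_lt (by omega), Nat.div_eq_of_lt (by omega)]

theorem isUnitSummand_smallest {x₂ x₃ s₂ e : ℕ} (h : 1 + x₃ < s₂) (he : 1 + x₃ + e % s₂ < s₂) :
    IsUnitSummand x₂ x₃ s₂ (1 + x₃) (1 + x₃) e := by
  refine ⟨?_, ?_, ?_⟩
  · rw [Nat.div_eq_of_lt h, Nat.div_self (by omega)]
    omega
  · exact add_div_of_mod_lt (by rwa [Nat.mod_eq_of_lt h])
  · exact add_div_of_mod_lt (by rw [Nat.mod_self, zero_add]; exact Nat.mod_lt _ (by omega))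

theorem isUnitSummand_zero {x₂ x₃ s₂ s₃ c : ℕ} (h : c = 1 + x₂ * (c / s₂) + x₃ * (c / s₃)) :
    IsUnitSummand x₂ x₃ s₂ s₃ c 0 :=
  ⟨h, by simp, by simp⟩

/-- A common multiple of the moduli can be split off whenever it has height one. -/
theorem isUnitSummand_common_multiple {x₂ x₃ s₂ s₃ M₂ M₃ L e : ℕ} (hs₂ : 0 < s₂) (hs₃ : 0 < s₃)
    (h₂ : L = s₂ * M₂) (h₃ : L = s₃ * M₃) (hL : L = 1 + x₂ * M₂ + x₃ * M₃) :
    IsUnitSummand x₂ x₃ s₂ s₃ L e := by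
  have d₂ : L / s₂ = M₂ := by rw [h₂, Nat.mul_div_cancel_left _ hs₂]
  have d₃ : L / s₃ = M₃ := by rw [h₃, Nat.mul_div_cancel_left _ hs₃]
  refine ⟨by rw [d₂, d₃]; exact hL, ?_, ?_⟩
  · rw [d₂, h₂, Nat.mul_add_div hs₂]
  · rw [d₃, h₃, Nat.mul_add_div hs₃]

/-! ### Lifting splittings to the largest modulus -/

/-- Let `s₁ = t + x₁ L` with `L` a common multiple of `s₂, s₃` of height one and `t` a divisor of
`L`. Writing `b = a s₁ + ρ` and `y = a t + ρ`, the parameters `b` and `y` have the same residues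
modulo `s₂, s₃` and the same height, and a splitting of `y` compatible with the digits `(a, ρ)`
lifts to one of `b`. If `y ≥ L` then `L = a t + (L - a t)` can be split off `y`; the hypothesis
`core` handles the case `y < L`. -/
theorem exists_unit_summand_of_core {x₁ x₂ x₃ s₂ s₃ M₂ M₃ L t r₁ : ℕ} (hs₂ : 0 < s₂)
    (hs₃ : 0 < s₃) (ht : 0 < t) (h₂ : L = s₂ * M₂) (h₃ : L = s₃ * M₃)
    (hL : L = 1 + x₂ * M₂ + x₃ * M₃) (htr : t * r₁ = L)
    (core : ∀ a ρ, 0 < a * t + ρ → a * t + ρ < L → ∃ a₁ a₂ c e, a = a₁ + a₂ ∧ ρ = c + e ∧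
      IsUnitSummand x₂ x₃ s₂ s₃ (a₁ * t + c) (a₂ * t + e))
    {b : ℕ} (hb : 0 < b) (hbN : b < L * (1 + x₁ * r₁)) :
    ∃ c e, b = c + e ∧
      c = 1 + x₁ * (c / (t + x₁ * L)) + x₂ * (c / s₂) + x₃ * (c / s₃) ∧
      (c + e) / (t + x₁ * L) = c / (t + x₁ * L) + e / (t + x₁ * L) ∧
      (c + e) / s₂ = c / s₂ + e / s₂ ∧ (c + e) / s₃ = c / s₃ + e / s₃ := by
  obtain ⟨s₁, hs₁⟩ : ∃ s₁, s₁ = t + x₁ * L := ⟨_, rfl⟩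
  have hs₁pos : 0 < s₁ := by omega
  obtain ⟨a, ρ, hρ, rfl⟩ : ∃ a ρ, ρ < s₁ ∧ b = a * s₁ + ρ :=
    ⟨b / s₁, b % s₁, Nat.mod_lt _ hs₁pos, (Nat.div_add_mod' b s₁).symm⟩
  have har : a < r₁ := by
    have h1 : L * (1 + x₁ * r₁) = s₁ * r₁ := by
      rw [hs₁, add_mul, htr]
      ring
    have h2 : s₁ * a < s₁ * r₁ := by rw [← h1]; linarith [mul_comm a s₁]
    exact lt_of_mul_lt_mul_left h2 (Nat.zero_le _)
  have hat : a * t ≤ L := by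
    rw [← htr, mul_comm]
    exact Nat.mul_le_mul_left t har.le
  have hy : 0 < a * t + ρ := by
    rcases Nat.eq_zero_or_pos a with rfl | ha
    · simpa using hb
    · positivity
  obtain ⟨a₁, a₂, c, e, rfl, rfl, hu, hu₂, hu₃⟩ : ∃ a₁ a₂ c e, a = a₁ + a₂ ∧ ρ = c + e ∧
      IsUnitSummand x₂ x₃ s₂ s₃ (a₁ * t + c) (a₂ * t + e) := by
    by_cases hyL : a * t + ρ < L
    · exact core a ρ hy hyL
    · refine ⟨a, 0, L - a * t, ρ - (L - a * t), rfl, by omega, ?_⟩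
      rw [Nat.add_sub_cancel' hat]
      exact isUnitSummand_common_multiple hs₂ hs₃ h₂ h₃ hL
  have hdiv : ∀ s M, 0 < s → L = s * M → ∀ i f,
      (i * s₁ + f) / s = (i * t + f) / s + i * x₁ * M := by
    intro s M hs hM i f
    rw [← Nat.add_mul_div_left _ _ hs, hs₁, hM]
    congr 1
    ring
  have hdiv₁ : ∀ i f, f < s₁ → (i * s₁ + f) / s₁ = i := by
    intro i f hf
    rw [mul_comm, Nat.mul_add_div hs₁pos, Nat.div_eq_of_lt hf, add_zero]
  rw [← hs₁]
  have hsum : ∀ u : ℕ, a₁ * u + c + (a₂ * u + e) = (a₁ + a₂) * u + (c + e) := fun u => by ring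
  refine ⟨a₁ * s₁ + c, a₂ * s₁ + e, by ring, ?_, ?_, ?_, ?_⟩
  · rw [hdiv₁ _ _ (by omega), hdiv s₂ M₂ hs₂ h₂, hdiv s₃ M₃ hs₃ h₃]
    have h1 : a₁ * s₁ + c = a₁ * t + c + a₁ * x₁ * L := by rw [hs₁]; ring
    have h2 : a₁ * x₁ * L = a₁ * x₁ * (1 + x₂ * M₂ + x₃ * M₃) := by rw [← hL]
    rw [h1, h2]
    conv_lhs => rw [hu]
    ring
  · rw [hsum, hdiv₁ _ _ (by omega), hdiv₁ _ _ (by omega), hdiv₁ _ _ (by omega)]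
  · rw [hsum, hdiv s₂ M₂ hs₂ h₂, hdiv s₂ M₂ hs₂ h₂, hdiv s₂ M₂ hs₂ h₂, ← hsum, hu₂]
    ring
  · rw [hsum, hdiv s₃ M₃ hs₃ h₃, hdiv s₃ M₃ hs₃ h₃, hdiv s₃ M₃ hs₃ h₃, ← hsum, hu₃]
    ring

/-- If `t = 1` or `a = 0`, every splitting of `a t + ρ` is compatible with the digits `(a, ρ)`. -/
theorem exists_digits_of_splitting {a ρ t c e : ℕ} (h : t = 1 ∨ a = 0) (hce : a * t + ρ = c + e) :
    ∃ a₁ a₂ c' e', a = a₁ + a₂ ∧ ρ = c' + e' ∧ a₁ * t + c' = c ∧ a₂ * t + e' = e := by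
  rcases h with rfl | rfl
  · rcases le_total a c with h | h
    · exact ⟨a, 0, c - a, e, by omega, by omega, by omega, by omega⟩
    · exact ⟨c, a - c, 0, ρ, by omega, by omega, by omega, by omega⟩
  · exact ⟨0, 0, c, e, by omega, by omega, by omega, by omega⟩

/-- The case `s₃ = 1 + x₃`, `s₂ = L = (1 + x₂) s₃` of divisible moduli. -/
theorem core_of_dvd {x₂ x₃ t a ρ : ℕ} (hx₂ : 0 < x₂) (hx₃ : 0 < x₃)
    (ht : t = 1 ∨ t = 1 + x₃ ∨ t = (1 + x₂) * (1 + x₃))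
    (h0 : 0 < a * t + ρ) (hL : a * t + ρ < (1 + x₂) * (1 + x₃)) :
    ∃ a₁ a₂ c e, a = a₁ + a₂ ∧ ρ = c + e ∧
      IsUnitSummand x₂ x₃ ((1 + x₂) * (1 + x₃)) (1 + x₃) (a₁ * t + c) (a₂ * t + e) := by
  have hlt : 1 + x₃ < (1 + x₂) * (1 + x₃) := by nlinarith
  have hsmall : ∀ e, 1 + x₃ + e < (1 + x₂) * (1 + x₃) →
      IsUnitSummand x₂ x₃ ((1 + x₂) * (1 + x₃)) (1 + x₃) (1 + x₃) e := fun e he =>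
    isUnitSummand_smallest hlt (by rwa [Nat.mod_eq_of_lt (by omega)])
  by_cases hfree : t = 1 ∨ a = 0
  · obtain ⟨c, e, hce, hu⟩ : ∃ c e, a * t + ρ = c + e ∧
        IsUnitSummand x₂ x₃ ((1 + x₂) * (1 + x₃)) (1 + x₃) c e := by
      by_cases hy : 1 + x₃ ≤ a * t + ρ
      · exact ⟨1 + x₃, a * t + ρ - (1 + x₃), by omega, hsmall _ (by omega)⟩
      · exact ⟨1, a * t + ρ - 1, by omega, isUnitSummand_one hlt (by omega)⟩
    obtain ⟨a₁, a₂, c', e', ha, hρ, rfl, rfl⟩ := exists_digits_of_splitting hfree hce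
    exact ⟨a₁, a₂, c', e', ha, hρ, hu⟩
  · push Not at hfree
    obtain ⟨ht1, ha⟩ := hfree
    obtain ⟨a, rfl⟩ := Nat.exists_eq_add_one_of_ne_zero ha
    rw [add_one_mul] at hL
    rcases ht with rfl | rfl | rfl
    · exact absurd rfl ht1
    · refine ⟨1, a, 0, ρ, by omega, by omega, ?_⟩
      rw [one_mul, add_zero]
      exact hsmall _ (by omega)
    · omega

/-- The splittings available for the coprime moduli `s₃ = 1 + x₃` and `s₂ = 1 + x₂ s₃`. Write
`y = y₂ s₂ + σ`; then `y ≡ y₂ + σ` modulo `s₃`. The exceptional case `y₂ + σ = s₃`, in which neither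
modulus can be split off, yields parameters of height one. -/
theorem exists_unit_summand_of_coprime {x₂ x₃ s₂ s₃ y : ℕ} (hx₂ : 0 < x₂) (hx₃ : 0 < x₃)
    (hs₃ : s₃ = 1 + x₃) (hs₂ : s₂ = 1 + x₂ * s₃) (h0 : 0 < y)
    (hy : y < s₂ * s₃) :
    (s₃ ≤ y % s₂ ∧ ∃ e, y = s₃ + e ∧ IsUnitSummand x₂ x₃ s₂ s₃ s₃ e) ∨
    (y < s₃ ∧ ∃ e, y = 1 + e ∧ IsUnitSummand x₂ x₃ s₂ s₃ 1 e) ∨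
    (¬ s₃ ∣ y ∧ ∃ e, y = s₂ + e ∧ IsUnitSummand x₂ x₃ s₂ s₃ s₂ e) ∨
    IsUnitSummand x₂ x₃ s₂ s₃ y 0 := by
  have hlt : s₃ < s₂ := by nlinarith
  have hs₂pos : 0 < s₂ := by omega
  obtain ⟨y₂, σ, hσ, rfl⟩ : ∃ y₂ σ, σ < s₂ ∧ y = s₂ * y₂ + σ :=
    ⟨y / s₂, y % s₂, Nat.mod_lt _ hs₂pos, (Nat.div_add_mod y s₂).symm⟩
  have hmod : (s₂ * y₂ + σ) % s₂ = σ := by rw [Nat.mul_add_mod, Nat.mod_eq_of_lt hσ]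
  have hy₂ : y₂ < s₃ := lt_of_mul_lt_mul_left (a := s₂) (by omega) (Nat.zero_le _)
  have hmod₃ : ∀ u v, (s₂ * u + v) % s₃ = (u + v) % s₃ := fun u v => by
    rw [show s₂ * u + v = u + v + s₃ * (x₂ * u) by rw [hs₂]; ring, Nat.add_mul_mod_self_left]
  by_cases h1 : s₃ ≤ σ
  · refine Or.inl ⟨by rwa [hmod], s₂ * y₂ + (σ - s₃), by omega, ?_⟩
    subst hs₃
    refine isUnitSummand_smallest hlt ?_
    rw [Nat.mul_add_mod, Nat.mod_eq_of_lt (by omega)]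
    omega
  rcases Nat.eq_zero_or_pos y₂ with rfl | hpos
  · refine Or.inr (Or.inl ⟨by omega, σ - 1, by omega, isUnitSummand_one hlt (by omega)⟩)
  by_cases h2 : y₂ + σ = s₃
  · refine Or.inr (Or.inr (Or.inr (isUnitSummand_zero ?_)))
    have d₂ : (s₂ * y₂ + σ) / s₂ = y₂ := by
      rw [Nat.mul_add_div hs₂pos, Nat.div_eq_of_lt hσ, add_zero]
    have h3 : s₂ * y₂ + σ = s₃ * (x₂ * y₂ + 1) := by
      rw [hs₂]
      linear_combination h2
    rw [d₂, h3, Nat.mul_div_cancel_left _ (by omega), hs₃]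
    ring
  · -- `y₂ + σ` lies strictly between `0` and `2 s₃` and is not `s₃`
    have h3 : ¬ s₃ ∣ s₂ * y₂ + σ := by
      rw [Nat.dvd_iff_mod_eq_zero, hmod₃]
      rcases lt_or_ge (y₂ + σ) s₃ with h | h
      · rw [Nat.mod_eq_of_lt h]
        omega
      · rw [Nat.mod_eq_sub_mod h, Nat.mod_eq_of_lt (by omega)]
        omega
    obtain ⟨z, rfl⟩ := Nat.exists_eq_add_one_of_ne_zero hpos.ne'
    have hx₂s : s₂ / s₃ = x₂ := by
      rw [hs₂, Nat.add_mul_div_right _ _ (by omega), Nat.div_eq_of_lt (by omega), zero_add]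
    refine Or.inr (Or.inr (Or.inl ⟨h3, s₂ * z + σ, by ring, ?_, ?_, ?_⟩))
    · rw [Nat.div_self hs₂pos, hx₂s]
      rw [hs₂, hs₃]
      ring
    · rw [Nat.add_div_left _ hs₂pos, Nat.div_self hs₂pos, add_comm]
    · have h4 : s₂ % s₃ = 1 := by
        rw [hs₂, Nat.add_mul_mod_self_right, Nat.mod_eq_of_lt (by omega)]
      refine add_div_of_mod_lt ?_
      rw [h4, hmod₃]
      rcases lt_or_ge (z + σ) s₃ with h | h
      · rw [Nat.mod_eq_of_lt h]
        omega
      · rw [Nat.mod_eq_sub_mod h, Nat.mod_eq_of_lt (by omega)]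
        omega

/-- The case `s₃ = 1 + x₃`, `s₂ = 1 + x₂ s₃`, `L = s₂ s₃` of coprime moduli. -/
theorem core_of_coprime {x₂ x₃ s₂ s₃ t a ρ : ℕ} (hx₂ : 0 < x₂) (hx₃ : 0 < x₃)
    (hs₃ : s₃ = 1 + x₃) (hs₂ : s₂ = 1 + x₂ * s₃)
    (ht : t = 1 ∨ t = s₃ ∨ t = s₂ ∨ t = s₂ * s₃)
    (h0 : 0 < a * t + ρ) (hL : a * t + ρ < s₂ * s₃) :
    ∃ a₁ a₂ c e, a = a₁ + a₂ ∧ ρ = c + e ∧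
      IsUnitSummand x₂ x₃ s₂ s₃ (a₁ * t + c) (a₂ * t + e) := by
  have hlt : s₃ < s₂ := by nlinarith
  have key := exists_unit_summand_of_coprime hx₂ hx₃ hs₃ hs₂ h0 hL
  by_cases hfree : t = 1 ∨ a = 0
  · obtain ⟨c, e, hce, hu⟩ : ∃ c e, a * t + ρ = c + e ∧
        IsUnitSummand x₂ x₃ s₂ s₃ c e := by
      rcases key with ⟨-, e, he, hu⟩ | ⟨-, e, he, hu⟩ | ⟨-, e, he, hu⟩ | hu
      · exact ⟨_, e, he, hu⟩
      · exact ⟨_, e, he, hu⟩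
      · exact ⟨_, e, he, hu⟩
      · exact ⟨_, 0, rfl, hu⟩
    obtain ⟨a₁, a₂, c', e', ha, hρ, rfl, rfl⟩ := exists_digits_of_splitting hfree hce
    exact ⟨a₁, a₂, c', e', ha, hρ, hu⟩
  push Not at hfree
  obtain ⟨ht1, ha⟩ := hfree
  obtain ⟨a, rfl⟩ := Nat.exists_eq_add_one_of_ne_zero ha
  rcases ht with ht | ht | ht | ht <;> replace ht := ht.symm <;> subst ht
  · exact absurd rfl ht1
  · rcases key with ⟨-, e, he, hu⟩ | ⟨hy, -⟩ | ⟨hndvd, e, he, hu⟩ | hu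
    · refine ⟨1, a, 0, ρ, by omega, by omega, ?_⟩
      rw [add_one_mul] at he
      rw [one_mul, add_zero, show a * s₃ + ρ = e by omega]
      exact hu
    · rw [add_one_mul] at hy
      omega
    · -- `s₂ = x₂ t + 1` needs a remainder `ρ ≥ 1`, which exists as `s₃ = t` does not divide
      -- `a t + ρ`
      have hρ : 0 < ρ := Nat.pos_of_ne_zero fun h => hndvd (by
        rw [h, add_zero]
        exact dvd_mul_left _ _)
      rcases le_total x₂ (a + 1) with h | h
      · refine ⟨x₂, a + 1 - x₂, 1, ρ - 1, by omega, by omega, ?_⟩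
        have h1 : (a + 1 - x₂) * s₃ + (ρ - 1) = e := by
          zify [h, Nat.one_le_iff_ne_zero.2 hρ.ne'] at he ⊢
          rw [show (s₂ : ℤ) = 1 + x₂ * s₃ by exact_mod_cast hs₂] at he
          linear_combination he
        rw [h1, show x₂ * s₃ + 1 = s₂ by omega]
        exact hu
      · have h2 : (a + 1) * s₃ ≤ x₂ * s₃ := Nat.mul_le_mul_right _ h
        refine ⟨a + 1, 0, s₂ - (a + 1) * s₃, e, rfl, by omega, ?_⟩
        rw [Nat.add_sub_cancel' (by omega), zero_mul, zero_add]
        exact hu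
    · refine ⟨a + 1, 0, ρ, 0, by omega, by omega, ?_⟩
      rw [zero_mul, zero_add]
      exact hu
  · rcases key with ⟨hle, e, he, hu⟩ | ⟨hy, -⟩ | ⟨-, e, he, hu⟩ | hu
    · have hρ : s₃ ≤ ρ := by
        rw [Nat.mul_add_mod_self_right] at hle
        exact hle.trans (Nat.mod_le _ _)
      refine ⟨0, a + 1, s₃, ρ - s₃, by omega, by omega, ?_⟩
      rw [zero_mul, zero_add, show (a + 1) * s₂ + (ρ - s₃) = e by omega]
      exact hu
    · rw [add_one_mul] at hy
      omega
    · refine ⟨1, a, 0, ρ, by omega, by omega, ?_⟩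
      rw [add_one_mul] at he
      rw [one_mul, add_zero, show a * s₂ + ρ = e by omega]
      exact hu
    · refine ⟨a + 1, 0, ρ, 0, by omega, by omega, ?_⟩
      rw [zero_mul, zero_add]
      exact hu
  · rw [add_one_mul] at hL
    omega

/-! ### Two families of support vectors -/

theorem isSupportPair_vec3 {a b c : ℕ} {x : Fin 3 → ℕ} (hx : ∀ j, 0 < x j) (ha : 0 < a)
    (hab : a < b) (hbc : b < c) : IsSupportPair ![a, b, c] x := by
  refine ⟨?_, ?_, hx⟩
  · rw [Fin.strictMono_iff_lt_succ]
    intro i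
    fin_cases i
    · exact hab
    · exact hbc
  · intro j
    fin_cases j
    · exact ha
    · exact ha.trans hab
    · exact (ha.trans hab).trans hbc

/-- The parameters of all three weights have height one if `t`, `s₂`, `s₃` and the common multiple
`L` have height one with respect to the two moduli `s₂`, `s₃`. -/
theorem hasUnitHeight_of_lower {x : Fin 3 → ℕ} {s₂ s₃ M₂ M₃ L t : ℕ} (hx : ∀ j, 0 < x j)
    (hs₃ : s₃ = 1 + x 2) (hlt : s₃ < s₂) (hle : s₂ ≤ L) (ht : 0 < t)
    (h₂ : L = s₂ * M₂) (h₃ : L = s₃ * M₃) (hL : L = 1 + x 1 * M₂ + x 2 * M₃)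
    (hut : t = 1 + x 1 * (t / s₂) + x 2 * (t / s₃)) (hu₂ : s₂ = 1 + x 1 + x 2 * (s₂ / s₃)) (j) :
    HasUnitHeight ![t + x 0 * L, s₂, s₃] x (![t + x 0 * L, s₂, s₃] j) := by
  have hLs₁ : L < t + x 0 * L := by nlinarith [hx 0]
  have hdiv : ∀ s M, 0 < s → L = s * M → (t + x 0 * L) / s = t / s + x 0 * M := by
    intro s M hs hM
    rw [← Nat.add_mul_div_left _ _ hs, hM]
    congr 1
    ring
  unfold HasUnitHeight
  rw [Fin.sum_univ_three]
  fin_cases j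
  · change t + x 0 * L = 1 + (x 0 * ((t + x 0 * L) / (t + x 0 * L)) +
      x 1 * ((t + x 0 * L) / s₂) + x 2 * ((t + x 0 * L) / s₃))
    rw [Nat.div_self (by omega), hdiv s₂ M₂ (by omega) h₂, hdiv s₃ M₃ (by omega) h₃]
    have : x 0 * L = x 0 * (1 + x 1 * M₂ + x 2 * M₃) := by rw [← hL]
    rw [this]
    conv_lhs => rw [hut]
    ring
  · change s₂ = 1 + (x 0 * (s₂ / (t + x 0 * L)) + x 1 * (s₂ / s₂) + x 2 * (s₂ / s₃))
    rw [Nat.div_eq_of_lt (show s₂ < t + x 0 * L by omega), Nat.div_self (by omega)]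
    omega
  · change s₃ = 1 + (x 0 * (s₃ / (t + x 0 * L)) + x 1 * (s₃ / s₂) + x 2 * (s₃ / s₃))
    rw [Nat.div_eq_of_lt (show s₃ < t + x 0 * L by omega), Nat.div_eq_of_lt hlt,
      Nat.div_self (by omega)]
    omega

theorem isIDP_of_core {r x : Fin 3 → ℕ} {s₂ s₃ M₂ M₃ L t r₁ : ℕ}
    (hS : ∀ j, (![t + x 0 * L, s₂, s₃] : Fin 3 → ℕ) j * r j = 1 + ∑ i, x i * r i)
    (hr : r 0 = r₁) (hs₂ : 0 < s₂) (hs₃ : 0 < s₃) (ht : 0 < t)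
    (h₂ : L = s₂ * M₂) (h₃ : L = s₃ * M₃) (hL : L = 1 + x 1 * M₂ + x 2 * M₃) (htr : t * r₁ = L)
    (core : ∀ a ρ, 0 < a * t + ρ → a * t + ρ < L → ∃ a₁ a₂ c e, a = a₁ + a₂ ∧ ρ = c + e ∧
      IsUnitSummand (x 1) (x 2) s₂ s₃ (a₁ * t + c) (a₂ * t + e)) :
    IsIDP (weightedSimplex (weightVector r x)) := by
  refine isIDP_weightVector hS fun b hb hbN => ?_
  have hN : 1 + ∑ i, x i * r i = L * (1 + x 0 * r₁) := by
    rw [← hS 0, hr]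
    change (t + x 0 * L) * r₁ = _
    linear_combination htr
  rw [hN] at hbN
  obtain ⟨c, e, hce, hu, h1, h2, h3⟩ :=
    exists_unit_summand_of_core hs₂ hs₃ ht h₂ h₃ hL htr core hb hbN
  refine ⟨c, e, hce, ?_, fun j => ?_⟩
  · unfold HasUnitHeight
    rw [Fin.sum_univ_three, ← add_assoc, ← add_assoc]
    exact hu
  · fin_cases j
    · exact h1
    · exact h2
    · exact h3

/-- The family with divisible moduli `s₃ ∣ s₂`: types (i), (ii), (iii). -/
theorem of_dvd_family {r x : Fin 3 → ℕ} (hx : ∀ j, 0 < x j) {t r₁ : ℕ}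
    (ht : t = 1 ∨ t = 1 + x 2 ∨ t = (1 + x 1) * (1 + x 2)) (htr : t * r₁ = (1 + x 1) * (1 + x 2))
    (hr : r = ![r₁, 1 + x 0 * r₁, (1 + x 0 * r₁) * (1 + x 1)]) :
    IsSupportPair r x ∧ NecessaryCondition r x ∧
      IsReflexivePolytope (weightedSimplex (weightVector r x)) ∧
      IsIDP (weightedSimplex (weightVector r x)) := by
  have h0 := hx 0
  have h1 := hx 1
  have h2 := hx 2
  have htpos : 0 < t := by rcases ht with rfl | rfl | rfl <;> positivity
  have hr₁ : 0 < r₁ := Nat.pos_of_ne_zero fun h => by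
    rw [h, mul_zero] at htr
    exact absurd htr (by positivity)
  have hlt : 1 + x 2 < (1 + x 1) * (1 + x 2) := by nlinarith
  have hS : ∀ j, (![t + x 0 * ((1 + x 1) * (1 + x 2)), (1 + x 1) * (1 + x 2), 1 + x 2] :
      Fin 3 → ℕ) j * r j = 1 + ∑ i, x i * r i := by
    rw [Fin.sum_univ_three, hr]
    intro j
    fin_cases j
    · change (t + x 0 * ((1 + x 1) * (1 + x 2))) * r₁ = 1 + (x 0 * r₁ + x 1 * (1 + x 0 * r₁) +
        x 2 * ((1 + x 0 * r₁) * (1 + x 1)))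
      linear_combination htr
    · change (1 + x 1) * (1 + x 2) * (1 + x 0 * r₁) = 1 + (x 0 * r₁ + x 1 * (1 + x 0 * r₁) +
        x 2 * ((1 + x 0 * r₁) * (1 + x 1)))
      ring
    · change (1 + x 2) * ((1 + x 0 * r₁) * (1 + x 1)) = 1 + (x 0 * r₁ + x 1 * (1 + x 0 * r₁) +
        x 2 * ((1 + x 0 * r₁) * (1 + x 1)))
      ring
  have hd : (1 + x 1) * (1 + x 2) / (1 + x 2) = 1 + x 1 :=
    Nat.mul_div_cancel _ (by positivity)
  refine ⟨?_, ?_, isReflexivePolytope_of_mul_eq (weightVector_mul_eq hS), ?_⟩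
  · rw [hr]
    exact isSupportPair_vec3 hx hr₁ (by nlinarith)
      (lt_mul_of_one_lt_right (by positivity) (by omega))
  · rw [necessaryCondition_iff_hasUnitHeight hS]
    refine hasUnitHeight_of_lower (M₂ := 1) (M₃ := 1 + x 1) hx rfl hlt le_rfl htpos (by ring)
      (by ring) (by ring) ?_ (by rw [hd]; ring)
    rcases ht with rfl | rfl | rfl
    · exact (isUnitSummand_one hlt (e := 0) (by omega)).1
    · exact (isUnitSummand_smallest hlt (e := 0) (by rwa [Nat.zero_mod])).1
    · rw [hd, Nat.div_self (by positivity)]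
      ring
  · exact isIDP_of_core (M₂ := 1) (M₃ := 1 + x 1) hS (by rw [hr]; rfl) (by positivity)
      (by positivity) htpos (by ring) (by ring) (by ring) htr
      fun a ρ => core_of_dvd h1 h2 ht

theorem mul_eq_of_coprime_family {r x : Fin 3 → ℕ} {t r₁ : ℕ}
    (htr : t * r₁ = (1 + x 1 * (1 + x 2)) * (1 + x 2))
    (hr : r = ![r₁, (1 + x 2) * (1 + x 0 * r₁), (1 + x 0 * r₁) * (1 + x 1 * (1 + x 2))]) (j) :
    (![t + x 0 * ((1 + x 1 * (1 + x 2)) * (1 + x 2)), 1 + x 1 * (1 + x 2), 1 + x 2] :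
      Fin 3 → ℕ) j * r j = 1 + ∑ i, x i * r i := by
  rw [Fin.sum_univ_three, hr]
  fin_cases j
  · change (t + x 0 * ((1 + x 1 * (1 + x 2)) * (1 + x 2))) * r₁ =
      1 + (x 0 * r₁ + x 1 * ((1 + x 2) * (1 + x 0 * r₁)) +
        x 2 * ((1 + x 0 * r₁) * (1 + x 1 * (1 + x 2))))
    linear_combination htr
  · change (1 + x 1 * (1 + x 2)) * ((1 + x 2) * (1 + x 0 * r₁)) =
      1 + (x 0 * r₁ + x 1 * ((1 + x 2) * (1 + x 0 * r₁)) +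
        x 2 * ((1 + x 0 * r₁) * (1 + x 1 * (1 + x 2))))
    ring
  · change (1 + x 2) * ((1 + x 0 * r₁) * (1 + x 1 * (1 + x 2))) =
      1 + (x 0 * r₁ + x 1 * ((1 + x 2) * (1 + x 0 * r₁)) +
        x 2 * ((1 + x 0 * r₁) * (1 + x 1 * (1 + x 2))))
    ring

/-- The family with coprime moduli `s₂ = 1 + x₂ s₃` and `s₃`: types (iv) to (viii). -/
theorem of_coprime_family {r x : Fin 3 → ℕ} (hx : ∀ j, 0 < x j) {t r₁ : ℕ}
    (hut : t = 1 + x 1 * (t / (1 + x 1 * (1 + x 2))) + x 2 * (t / (1 + x 2)))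
    (htr : t * r₁ = (1 + x 1 * (1 + x 2)) * (1 + x 2))
    (hr : r = ![r₁, (1 + x 2) * (1 + x 0 * r₁), (1 + x 0 * r₁) * (1 + x 1 * (1 + x 2))]) :
    IsSupportPair r x ∧ NecessaryCondition r x ∧
      IsReflexivePolytope (weightedSimplex (weightVector r x)) := by
  have h0 := hx 0
  have h1 := hx 1
  have h2 := hx 2
  have hr₁ : 0 < r₁ := Nat.pos_of_ne_zero fun h => by
    rw [h, mul_zero] at htr
    exact absurd htr (by positivity)
  have hS := mul_eq_of_coprime_family htr hr
  have hlt : 1 + x 2 < 1 + x 1 * (1 + x 2) := by nlinarith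
  have hd : (1 + x 1 * (1 + x 2)) / (1 + x 2) = x 1 := by
    rw [Nat.add_mul_div_right _ _ (by positivity), Nat.div_eq_of_lt (by omega), zero_add]
  refine ⟨?_, ?_, isReflexivePolytope_of_mul_eq (weightVector_mul_eq hS)⟩
  · rw [hr]
    have hR : r₁ < 1 + x 0 * r₁ := by nlinarith
    refine isSupportPair_vec3 hx hr₁ (hR.trans_le (Nat.le_mul_of_pos_left _ (by positivity))) ?_
    rw [mul_comm]
    exact Nat.mul_lt_mul_of_pos_left hlt (by positivity)
  · rw [necessaryCondition_iff_hasUnitHeight hS]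
    exact hasUnitHeight_of_lower (M₂ := 1 + x 2) (M₃ := 1 + x 1 * (1 + x 2)) hx rfl hlt
      (Nat.le_mul_of_pos_right _ (by positivity)) (by omega) rfl (by ring) (by ring) hut
      (by rw [hd]; ring)

/-- The members of the coprime family with `t ∈ {1, s₃, s₂, s₂ s₃}`: types (iv) to (vii). -/
theorem of_coprime_family_of_mem {r x : Fin 3 → ℕ} (hx : ∀ j, 0 < x j) {t r₁ : ℕ}
    (ht : t = 1 ∨ t = 1 + x 2 ∨ t = 1 + x 1 * (1 + x 2) ∨
      t = (1 + x 1 * (1 + x 2)) * (1 + x 2))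
    (htr : t * r₁ = (1 + x 1 * (1 + x 2)) * (1 + x 2))
    (hr : r = ![r₁, (1 + x 2) * (1 + x 0 * r₁), (1 + x 0 * r₁) * (1 + x 1 * (1 + x 2))]) :
    IsSupportPair r x ∧ NecessaryCondition r x ∧
      IsReflexivePolytope (weightedSimplex (weightVector r x)) ∧
      IsIDP (weightedSimplex (weightVector r x)) := by
  have h1 := hx 1
  have h2 := hx 2
  have htpos : 0 < t := by rcases ht with rfl | rfl | rfl | rfl <;> positivity
  have hlt : 1 + x 2 < 1 + x 1 * (1 + x 2) := by nlinarith
  have hd : (1 + x 1 * (1 + x 2)) / (1 + x 2) = x 1 := by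
    rw [Nat.add_mul_div_right _ _ (by positivity), Nat.div_eq_of_lt (by omega), zero_add]
  have hut : t = 1 + x 1 * (t / (1 + x 1 * (1 + x 2))) + x 2 * (t / (1 + x 2)) := by
    rcases ht with rfl | rfl | rfl | rfl
    · exact (isUnitSummand_one hlt (e := 0) (by omega)).1
    · exact (isUnitSummand_smallest hlt (e := 0) (by rwa [Nat.zero_mod])).1
    · rw [hd, Nat.div_self (by positivity)]
      ring
    · rw [Nat.mul_div_cancel _ (by positivity), Nat.mul_div_cancel_left _ (by positivity)]
      ring
  obtain ⟨hsp, hnc, hrefl⟩ := of_coprime_family hx hut htr hr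
  refine ⟨hsp, hnc, hrefl, ?_⟩
  exact isIDP_of_core (M₂ := 1 + x 2) (M₃ := 1 + x 1 * (1 + x 2))
    (mul_eq_of_coprime_family htr hr) (by rw [hr]; rfl) (by positivity) (by positivity) htpos rfl
    (by ring) (by ring) htr fun a ρ => core_of_coprime h1 h2 rfl rfl ht

theorem IsTypeItoVII.isReflexive_isIDP {r x : Fin 3 → ℕ} (hx : ∀ j, 0 < x j)
    (h : IsTypeItoVII r x) :
    IsSupportPair r x ∧ NecessaryCondition r x ∧
      IsReflexivePolytope (weightedSimplex (weightVector r x)) ∧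
      IsIDP (weightedSimplex (weightVector r x)) := by
  rcases h with h | h | h | h | h | h | h
  · exact of_dvd_family hx (Or.inr (Or.inr rfl)) (mul_one _)
      (h.trans (Matrix.vec3_eq rfl (by ring) (by ring)))
  · exact of_dvd_family hx (Or.inr (Or.inl rfl)) (mul_comm _ _) h
  · exact of_dvd_family hx (Or.inl rfl) (one_mul _)
      (h.trans (Matrix.vec3_eq rfl (by ring) (by ring)))
  · exact of_coprime_family_of_mem hx (Or.inr (Or.inr (Or.inr rfl))) (mul_one _)
      (h.trans (Matrix.vec3_eq rfl (by ring) (by ring)))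
  · exact of_coprime_family_of_mem hx (Or.inr (Or.inl rfl)) (mul_comm _ _)
      (h.trans (Matrix.vec3_eq (by ring) (by ring) (by ring)))
  · exact of_coprime_family_of_mem hx (Or.inl rfl) (one_mul _)
      (h.trans (Matrix.vec3_eq (by ring) (by ring) (by ring)))
  · exact of_coprime_family_of_mem hx (Or.inr (Or.inr (Or.inl rfl))) rfl
      (h.trans (Matrix.vec3_eq (by ring) (by ring) (by ring)))

/-! ### Type (viii) -/

/-- Here `s₃ = k + s r₁`, `s₂ = r₁ m` and `t = m s₃` with `m = 1 + s x₂`. The parameter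
`b = x₁ L + (s + 1) s₂ = s₁ + (s₂ - k m)` has height `s + 1`. A summand `c ≥ s₁` of `b` must be
congruent to `b` modulo `s₂`, since `s₂ ∣ b`; as `b - s₁ < s₂`, this forces `c = b`. -/
theorem IsTypeVIII.not_isIDP {r x : Fin 3 → ℕ} (hx : ∀ j, 0 < x j) (h : IsTypeVIII r x) :
    IsSupportPair r x ∧ NecessaryCondition r x ∧
      IsReflexivePolytope (weightedSimplex (weightVector r x)) ∧
      ¬ IsIDP (weightedSimplex (weightVector r x)) := by
  obtain ⟨k, s, hk, hs, hx2, hr⟩ := h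
  have h0 := hx 0
  have h1 := hx 1
  have h2 := hx 2
  rw [← hx2, add_comm (x 2) 1] at hr
  obtain ⟨s₃, hs₃⟩ : ∃ s₃, s₃ = 1 + x 2 := ⟨_, rfl⟩
  obtain ⟨s₂, hs₂⟩ : ∃ s₂, s₂ = 1 + x 1 * (1 + x 2) := ⟨_, rfl⟩
  obtain ⟨m, hm⟩ : ∃ m, m = 1 + s * x 1 := ⟨_, rfl⟩
  have hs₃' : s₃ = k + s * (1 + k * x 1) := by linarith
  have hs₂' : s₂ = (1 + k * x 1) * m := by
    rw [hs₂, ← hs₃, hs₃', hm]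
    ring
  have hs₂pos : 0 < s₂ := by omega
  have hs₃pos : 0 < s₃ := by omega
  have htr : m * s₃ * (1 + k * x 1) = s₂ * s₃ := by
    rw [hs₂']
    ring
  have ht : m * s₃ = s₂ * s + k * m := by
    rw [hs₂', hs₃']
    ring
  have hkm : k * m < s₂ := by
    rw [hs₂']
    nlinarith
  have hut : m * s₃ = 1 + x 1 * (m * s₃ / (1 + x 1 * (1 + x 2))) + x 2 * (m * s₃ / (1 + x 2)) := by
    rw [← hs₂, ← hs₃, Nat.mul_div_cancel _ hs₃pos]
    rw [show m * s₃ / s₂ = s by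
      rw [ht, Nat.mul_add_div hs₂pos, Nat.div_eq_of_lt hkm, add_zero]]
    rw [hs₃, hm]
    ring
  have htr' := htr
  rw [hs₂] at htr'
  nth_rewrite 2 [hs₃] at htr'
  obtain ⟨hsp, hnc, hrefl⟩ := of_coprime_family hx hut htr' hr
  refine ⟨hsp, hnc, hrefl, fun hidp => ?_⟩
  have hS := mul_eq_of_coprime_family htr' hr
  rw [← hs₂, ← hs₃] at hS
  obtain ⟨s₁, hs₁⟩ : ∃ s₁, s₁ = m * s₃ + x 0 * (s₂ * s₃) := ⟨_, rfl⟩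
  rw [← hs₁] at hS
  have hs₂s₃ : s₂ ≤ s₂ * s₃ := Nat.le_mul_of_pos_right _ hs₃pos
  have hs₂s₁ : s₂ ≤ s₁ := by nlinarith
  have hb : x 0 * (s₂ * s₃) + (s + 1) * s₂ = s₁ + (s₂ - k * m) := by
    have : s₂ - k * m + k * m = s₂ := Nat.sub_add_cancel hkm.le
    linarith
  obtain ⟨b, hbdef⟩ : ∃ b, b = x 0 * (s₂ * s₃) + (s + 1) * s₂ := ⟨_, rfl⟩
  have hkmpos : 0 < k * m := by
    rw [hm]
    positivity
  have hb₁ : b / s₁ = 1 := by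
    rw [hbdef, hb, Nat.add_div_left _ (by omega), Nat.div_eq_of_lt (by omega)]
  have hb₂' : b = s₂ * (x 0 * s₃ + s + 1) := by
    rw [hbdef]
    ring
  have hb₂ : b / s₂ = x 0 * s₃ + s + 1 := by rw [hb₂', Nat.mul_div_cancel_left _ hs₂pos]
  have hb₃ : b / s₃ = x 0 * s₂ + x 1 * (s + 1) := by
    have h3 : b = s₃ * (x 0 * s₂ + x 1 * (s + 1)) + (s + 1) := by
      have : s₂ = 1 + x 1 * s₃ := by rw [hs₂, hs₃]
      rw [hbdef]
      linear_combination (s + 1) * this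
    have h4 : s + 1 < s₃ := by
      rw [hs₃']
      nlinarith [Nat.mul_pos hk h1, Nat.mul_pos hs (Nat.mul_pos hk h1)]
    rw [h3, Nat.mul_add_div hs₃pos, Nat.div_eq_of_lt h4, add_zero]
  have hheight : 1 + ∑ j, x j * (b / (![s₁, s₂, s₃] : Fin 3 → ℕ) j) + s = b := by
    rw [Fin.sum_univ_three]
    change 1 + (x 0 * (b / s₁) + x 1 * (b / s₂) + x 2 * (b / s₃)) + s = b
    rw [hb₁, hb₂, hb₃, hbdef, hs₂, hs₃]
    ring
  obtain ⟨c, e, hce, hc, hu, hadd⟩ := exists_summand_of_isIDP hx hS hidp (b := b) (j₀ := 0)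
    (by omega) (by
      change s₁ ≤ b
      omega)
  have hc : s₁ ≤ c := hc
  have hadd : (c + e) / s₂ = c / s₂ + e / s₂ := hadd 1
  have he : e = 0 := by
    have h3 : s₂ * ((c + e) / s₂) = c + e := by
      rw [← hce, hb₂, hb₂']
    have h4 := Nat.div_add_mod c s₂
    have h5 := Nat.div_add_mod e s₂
    rw [hadd, mul_add] at h3
    have h6 : e / s₂ = 0 := Nat.div_eq_of_lt (by omega)
    rw [h6] at h5 h3
    omega
  unfold HasUnitHeight at hu
  have : c = b := by omega
  rw [this] at hu
  omega

/-! ### The classification -/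

theorem mod_cases_of_le {u m : ℕ} (h : u ≤ m) : u % m = u ∧ u < m ∨ u % m = 0 ∧ u = m := by
  rcases h.lt_or_eq with h | h
  · exact Or.inl ⟨Nat.mod_eq_of_lt h, h⟩
  · exact Or.inr ⟨by rw [h, Nat.mod_self], h⟩

/-- The condition at `r₃` reads `r₃ = 1 + x₁ r₁ + x₂ r₂`, which reduces the condition at `r₂` to
one on `1 + x₁ r₁` modulo `r₂`, and modulo `r₁` the weights `r₂, r₃` become expressions in `x₂,
x₃` alone. The cases are whether a number which the equations bound by the modulus is equal to it
or less; only `1 + x₃` can exceed the modulus `r₁`, and its quotient by `r₁` is the `s` of type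
(viii). -/
theorem NecessaryCondition.isType {r x : Fin 3 → ℕ} (hx : ∀ j, 0 < x j)
    (hsp : IsSupportPair r x) (hnc : NecessaryCondition r x) :
    IsTypeItoVII r x ∨ IsTypeVIII r x := by
  obtain ⟨r₁, r₂, r₃, rfl⟩ : ∃ r₁ r₂ r₃, r = ![r₁, r₂, r₃] :=
    ⟨r 0, r 1, r 2, by funext j; fin_cases j <;> rfl⟩
  obtain ⟨x₁, x₂, x₃, rfl⟩ : ∃ x₁ x₂ x₃, x = ![x₁, x₂, x₃] :=
    ⟨x 0, x 1, x 2, by funext j; fin_cases j <;> rfl⟩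
  have hx₁ : 0 < x₁ := hx 0
  have hx₂ : 0 < x₂ := hx 1
  have hx₃ : 0 < x₃ := hx 2
  have hr₁ : 0 < r₁ := hsp.2.1 0
  have h12 : r₁ < r₂ := hsp.1 (show (0 : Fin 3) < 1 by decide)
  have h23 : r₂ < r₃ := hsp.1 (show (1 : Fin 3) < 2 by decide)
  have e₁ := hnc 0
  have e₂ := hnc 1
  have e₃ := hnc 2
  rw [Fin.sum_univ_three] at e₁ e₂ e₃
  change 1 + (x₁ * (r₁ % r₁) + x₂ * (r₂ % r₁) + x₃ * (r₃ % r₁)) = r₁ at e₁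
  change 1 + (x₁ * (r₁ % r₂) + x₂ * (r₂ % r₂) + x₃ * (r₃ % r₂)) = r₂ at e₂
  change 1 + (x₁ * (r₁ % r₃) + x₂ * (r₂ % r₃) + x₃ * (r₃ % r₃)) = r₃ at e₃
  rw [Nat.mod_self, mul_zero] at e₁ e₂ e₃
  rw [Nat.mod_eq_of_lt h12] at e₂
  rw [Nat.mod_eq_of_lt (h12.trans h23), Nat.mod_eq_of_lt h23] at e₃
  change IsTypeItoVII _ _ ∨ IsTypeVIII _ _
  unfold IsTypeItoVII IsTypeVIII
  change (_ = typeI x₁ x₂ x₃ ∨ _ = typeII x₁ x₂ x₃ ∨ _ = typeIII x₁ x₂ x₃ ∨ _ = typeIV x₁ x₂ x₃ ∨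
    _ = typeV x₁ x₂ x₃ ∨ _ = typeVI x₁ x₂ x₃ ∨ _ = typeVII x₁ x₂ x₃) ∨
    ∃ k s : ℕ, 1 ≤ k ∧ 1 ≤ s ∧ x₃ + 1 = s * k * x₂ + s + k ∧
    ![r₁, r₂, r₃] = ![1 + k * x₂, (s * k * x₂ + s + k) * (1 + x₁ * (1 + k * x₂)),
          (1 + x₁ * (1 + k * x₂)) * (1 + x₂ * (s * k * x₂ + s + k))]
  have hr₃ : r₃ = 1 + x₁ * r₁ + r₂ * x₂ := by rw [← e₃]; ring
  have hmod₃ : r₃ % r₂ = (1 + x₁ * r₁) % r₂ := by rw [hr₃, Nat.add_mul_mod_self_left]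
  have hmod₁ : ∀ u, (1 + x₁ * r₁) * u % r₁ = u % r₁ := fun u => by
    rw [show (1 + x₁ * r₁) * u = u + r₁ * (x₁ * u) by ring, Nat.add_mul_mod_self_left]
  rw [hmod₃] at e₂
  rcases mod_cases_of_le (u := 1 + x₁ * r₁) (m := r₂) (by omega) with ⟨hR, -⟩ | ⟨-, hR⟩
  · -- `1 + x₁ r₁ < r₂`: the coprime family
    rw [hR] at e₂
    have hr₂ : r₂ = (1 + x₁ * r₁) * (1 + x₃) := by rw [← e₂]; ring
    have hr₃' : r₃ = (1 + x₁ * r₁) * (1 + x₂ * (1 + x₃)) := by rw [hr₃, hr₂]; ring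
    rw [hr₃', hmod₁, hr₂, hmod₁] at e₁
    have hmod : (1 + x₂ * (1 + x₃)) % r₁ = (1 + x₂ * ((1 + x₃) % r₁)) % r₁ := by
      conv_lhs => rw [← Nat.mod_add_div (1 + x₃) r₁]
      rw [show 1 + x₂ * ((1 + x₃) % r₁ + r₁ * ((1 + x₃) / r₁)) =
        1 + x₂ * ((1 + x₃) % r₁) + r₁ * (x₂ * ((1 + x₃) / r₁)) by ring, Nat.add_mul_mod_self_left]
    rw [hmod] at e₁
    obtain ⟨a, ha⟩ : ∃ a, a = (1 + x₃) % r₁ := ⟨_, rfl⟩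
    rw [← ha] at e₁
    subst hr₂ hr₃'
    rcases mod_cases_of_le (u := 1 + x₂ * a) (m := r₁) (by omega) with ⟨hA, -⟩ | ⟨hA, hA'⟩
    · rw [hA] at e₁
      have hr₁' : r₁ = (1 + x₂ * a) * (1 + x₃) := by rw [← e₁]; ring
      have hle : 1 + x₃ ≤ r₁ := by
        rw [hr₁']
        exact Nat.le_mul_of_pos_left _ (by omega)
      rcases mod_cases_of_le hle with ⟨hB, -⟩ | ⟨hB, hB'⟩
      · rw [← ha] at hB
        subst hB
        rw [hr₁']
        exact Or.inl (Or.inr (Or.inr (Or.inr (Or.inr (Or.inr (Or.inl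
          (Matrix.vec3_eq (by ring) (by ring) (by ring))))))))
      · rw [← hB']
        exact Or.inl (Or.inr (Or.inr (Or.inr (Or.inr (Or.inr (Or.inr
          (Matrix.vec3_eq (by ring) (by ring) (by ring))))))))
    · rcases Nat.eq_zero_or_pos a with rfl | hapos
      · have : r₁ = 1 := by omega
        subst this
        exact Or.inl (Or.inr (Or.inr (Or.inr (Or.inl
          (Matrix.vec3_eq rfl (by ring) (by ring))))))
      · have hdm := Nat.mod_add_div (1 + x₃) r₁
        rw [← ha] at hdm
        rcases Nat.eq_zero_or_pos ((1 + x₃) / r₁) with hq | hq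
        · rw [hq, mul_zero, add_zero] at hdm
          rw [← hA', hdm]
          exact Or.inl (Or.inr (Or.inr (Or.inr (Or.inr (Or.inl
            (Matrix.vec3_eq (by ring) (by ring) (by ring)))))))
        · obtain ⟨s, hs⟩ : ∃ s, s = (1 + x₃) / r₁ := ⟨_, rfl⟩
          rw [← hs, ← hA'] at hdm
          rw [← hs] at hq
          have h3 : s * a * x₂ + s + a = 1 + x₃ := by rw [← hdm]; ring
          refine Or.inr ⟨a, s, hapos, hq, by omega, ?_⟩
          rw [h3, ← hA']
          exact Matrix.vec3_eq (by ring) (by ring) (by ring)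
  · -- `r₂ = 1 + x₁ r₁`: the family with divisible moduli
    have hr₃' : r₃ = (1 + x₁ * r₁) * (1 + x₂) := by rw [hr₃, ← hR]; ring
    have hmod₂ : r₂ % r₁ = 1 % r₁ := by rw [← hR, Nat.add_mul_mod_self_right]
    rw [hr₃', hmod₁, hmod₂] at e₁
    subst hR hr₃'
    rcases Nat.lt_or_ge 1 r₁ with h | h
    · rw [Nat.mod_eq_of_lt h] at e₁
      rcases mod_cases_of_le (u := 1 + x₂) (m := r₁) (by omega) with ⟨hA, -⟩ | ⟨-, hA'⟩
      · rw [hA] at e₁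
        have hr₁' : r₁ = (1 + x₂) * (1 + x₃) := by rw [← e₁]; ring
        rw [hr₁']
        exact Or.inl (Or.inr (Or.inr (Or.inl (Matrix.vec3_eq rfl (by ring) (by ring)))))
      · subst hA'
        exact Or.inl (Or.inr (Or.inl rfl))
    · have : r₁ = 1 := by omega
      subst this
      exact Or.inl (Or.inl (Matrix.vec3_eq rfl (by ring) (by ring)))

theorem theorem3p6 (r x : Fin 3 → ℕ) (hx : ∀ j, 0 < x j) :
    -- the necessary condition forces one of the eight forms
    (IsSupportPair r x → NecessaryCondition r x → IsTypeItoVII r x ∨ IsTypeVIII r x) ∧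
    -- types (i)–(vii) give 3-supported vectors whose simplices are reflexive and IDP
    (IsTypeItoVII r x →
      IsSupportPair r x ∧ NecessaryCondition r x ∧
        IsReflexivePolytope (weightedSimplex (weightVector r x)) ∧
        IsIDP (weightedSimplex (weightVector r x))) ∧
    -- type (viii) gives 3-supported vectors whose simplices are reflexive and not IDP
    (IsTypeVIII r x →
      IsSupportPair r x ∧ NecessaryCondition r x ∧
        IsReflexivePolytope (weightedSimplex (weightVector r x)) ∧
        ¬ IsIDP (weightedSimplex (weightVector r x))) ∧
    -- the classification of the reflexive IDP simplices with three distinct weights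
    (IsSupportPair r x →
      ((IsReflexivePolytope (weightedSimplex (weightVector r x)) ∧
          IsIDP (weightedSimplex (weightVector r x))) ↔ IsTypeItoVII r x)) := by
  refine ⟨fun hsp hnc => hnc.isType hx hsp, fun h => h.isReflexive_isIDP hx,
    fun h => h.not_isIDP hx, fun hsp => ⟨fun ⟨hrefl, hidp⟩ => ?_, fun h => ?_⟩⟩
  · have hnc := necessaryCondition_of_isReflexivePolytope_of_isIDP hsp.2.1 hx hrefl hidp
    exact (hnc.isType hx hsp).resolve_right fun h => (h.not_isIDP hx).2.2.2 hidp
  · exact (h.isReflexive_isIDP hx).2.2
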